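/- **Theorem (Beurling–Lax–Halmos type theorem).** "A\*-algebra" means either "C\*-algebra" (possibly non-unital) or "W\*-algebra", with one fixed choice throughout. Let $\mathcal M$ be an A\*-algebra. An A\*-correspondence over $\mathcal M$ is a right Hilbert $\mathcal M$-module with a nondegenerate left action of $\mathcal M$ by adjointable operators (a $*$-homomorphism); in the W\*-case it is moreover self-dual and the left action is normal. Tensor products of correspondences are interior tensor products (their self-dual extensions in the W\*-case). Let $X=(X(n))_{n\ge 0}$ be a standard subproduct system over $\mathcal M$: a sequence of A\*-correspondences with $X(0)=\mathcal M$ such that each $X(n+m)$ is an orthogonally complemented sub-bimodule of $X(n)\otimes X(m)$, where the projections $U_{n,m}: X(n)\otimes X(m)\to X(n+m)$ (coisometric adjointable bimodule maps) satisfy $$U_{n,0}(\zeta\otimes a)=\zeta a,\qquad U_{0,n}(a\otimes \zeta)=a\zeta,\qquad U_{n+m,l}(U_{n,m}\otimes I)=U_{n,m+l}(I\otimes U_{m,l}).$$ Let $\mathcal F_X=\bigoplus_{n\ge 0}X(n)$ be the Fock space and, for $\zeta\in X(n)$, let $S_n(\zeta)$ be the operator on $\mathcal F_X$ with $S_n(\zeta)\eta=U_{n,m}(\zeta\otimes\eta)$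 for $\eta\in X(m)$. A representation of $\mathcal M$ on a Hilbert space is a nondegenerate $*$-homomorphism into its bounded operators, normal in the W\*-case. For a representation $\psi$ of $\mathcal M$ on a Hilbert space $\mathcal E$, the Hilbert space $\mathcal F_X\otimes_\psi\mathcal E$ has $\langle \xi\otimes h,\xi'\otimes h'\rangle=\langle h,\psi(\langle \xi,\xi'\rangle)h'\rangle$ and carries the operators $S_n(\zeta)\otimes I_{\mathcal E}$. Let $\psi$ be a representation of $\mathcal M$ on a Hilbert space $\mathcal E$, and let $\mathcal S$ be a closed subspace of $\mathcal F_X\otimes_\psi\mathcal E$. Then $\mathcal S$ is invariant under all $S_n(\zeta)\otimes I_{\mathcal E}$ ($n\ge 0$, $\zeta\in X(n)$) if and only if there exist a Hilbert space $\mathcal E'$, a representation $\pi$ of $\mathcal M$ on $\mathcal E'$, and an inner multi-analytic operator $\Pi:\mathcal F_X\otimes_\pi\mathcal E'\to\mathcal F_X\otimes_\psi\mathcal E$ with range $\mathcal S$, that is, a bounded operator $\Pi$ which is a partial isometry, has range exactly $\mathcal S$, and satisfies $$\Pi\,(S_n(\zeta)\otimes I_{\mathcal E'})=(S_n(\zeta)\otimes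 I_{\mathcal E})\,\Pi\qquad(n\ge 0,\ \zeta\in X(n)).$$ -/

import Mathlib

open scoped InnerProductSpace ComplexOrder TensorProduct ENNReal
open MulOpposite

universe u v w

noncomputable section

/-- The word "A*-algebra" stands for either a C*-algebra or a W*-algebra; `AStarKind` records which
of the two settings one works in. -/
inductive AStarKind
  | cstar
  | wstar

/-- A map between (partially) ordered sets is *normal* if it preserves suprema of increasing nets.
For positive linear maps between W*-algebras this is the usual notion of normality. -/
def IsNormalMap {A B : Type*} [Preorder A] [Preorder B] (f : A → B) : Prop :=
  ∀ (D : Set A) (s : A), D.Nonempty → DirectedOn (· ≤ ·) D → IsLUB D s → IsLUB (f '' D) (f s)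

/-- In the `cstar` setting `M` is any (possibly non-unital) C*-algebra; in the `wstar` setting the
C*-algebra `M` is (unital and) a W*-algebra. -/
def IsAStarAlgebra (k : AStarKind) (M : Type u) [inst : NonUnitalCStarAlgebra M] : Prop :=
  match k with
  | .cstar => True
  | .wstar => ∃ c : CStarAlgebra M, c.toNonUnitalCStarAlgebra = inst ∧ @WStarAlgebra M c

/-! ### Hilbert modules

A (right) Hilbert `M`-module is Mathlib's `CStarModule Mᵐᵒᵖ E`: the right action `x · a` is
`op a • x`, and the `M`-valued inner product, linear in the second variable, is `mip x y`. -/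

section Module

variable {M : Type u} [NonUnitalCStarAlgebra M] [PartialOrder M]
  {X : Type v} [NormedAddCommGroup X] [NormedSpace ℂ X] [SMul Mᵐᵒᵖ X] [CStarModule Mᵐᵒᵖ X]

variable (M) in
/-- The `M`-valued inner product `⟨x, y⟩` of a right Hilbert `M`-module. -/
def mip (x y : X) : M := unop (inner Mᵐᵒᵖ x y)

lemma mip_add_right (x y z : X) : mip M x (y + z) = mip M x y + mip M x z := by
  simp [mip]

lemma mip_add_left (x y z : X) : mip M (x + y) z = mip M x z + mip M y z := by
  simp [mip]

lemma mip_smul_right (c : ℂ) (x y : X) : mip M x (c • y) = c • mip M x y := by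
  simp [mip]

lemma mip_smul_left (c : ℂ) (x y : X) : mip M (c • x) y = star c • mip M x y := by
  simp [mip]

lemma mip_op_right (a : M) (x y : X) : mip M x (op a • y) = mip M x y * a := by
  simp [mip]

lemma mip_op_left (a : M) (x y : X) : mip M (op a • x) y = star a * mip M x y := by
  simp [mip]

lemma star_mip (x y : X) : star (mip M x y) = mip M y x := by
  rw [mip, ← unop_star, CStarModule.star_inner]; rfl

lemma mip_self_nonneg (x : X) : 0 ≤ mip M x x :=
  CStarModule.inner_self_nonneg (A := Mᵐᵒᵖ) (x := x)

lemma norm_mip_self (x : X) : ‖mip M x x‖ = ‖x‖ ^ 2 := by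
  rw [CStarModule.norm_sq_eq Mᵐᵒᵖ]; rfl

lemma mip_sum_right {ι : Type*} (s : Finset ι) (x : X) (y : ι → X) :
    mip M x (∑ i ∈ s, y i) = ∑ i ∈ s, mip M x (y i) := by
  simp [mip]

lemma mip_sum_left {ι : Type*} (s : Finset ι) (x : ι → X) (y : X) :
    mip M (∑ i ∈ s, x i) y = ∑ i ∈ s, mip M (x i) y := by
  simp [mip]

lemma mip_sub_right (x y z : X) : mip M x (y - z) = mip M x y - mip M x z := by
  simp [mip]

lemma mip_sub_left (x y z : X) : mip M (x - y) z = mip M x z - mip M y z := by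
  simp [mip]

lemma mip_ext {x y : X} (h : ∀ z, mip M z x = mip M z y) : x = y := by
  have h1 : mip M (x - y) (x - y) = 0 := by rw [mip_sub_right, h, sub_self]
  have h2 : inner Mᵐᵒᵖ (x - y) (x - y) = 0 := unop_injective h1
  exact sub_eq_zero.1 (CStarModule.inner_self.1 h2)

variable (M X) in
/-- A Hilbert module is *self-dual* if every bounded right-module map into `M` is the inner product
with a vector. -/
def IsSelfDual : Prop :=
  ∀ τ : X →L[ℂ] M, (∀ (a : M) (x : X), τ (op a • x) = τ x * a) → ∃ y : X, ∀ x, τ x = mip M y x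

variable (M) in
/-- The linear span of `s` is dense for the σ-topology of the Hilbert module `X`, that is, for the
topology generated by the functionals `x ↦ ∑ₙ ωₙ(⟨ηₙ, x⟩)` with `ωₙ` in the predual of `M`, `ηₙ` in
`X` and `∑ₙ ‖ωₙ‖ ‖ηₙ‖ < ∞`: every such functional that vanishes on `s` vanishes.  As every element
of the predual is a combination of four positive normal functionals of no larger norm, it is enough
to use positive normal `ωₙ`. -/
def IsSigmaTotal (s : Set X) : Prop :=
  ∀ (ω : ℕ → M →L[ℂ] ℂ) (η : ℕ → X), (∀ n a, 0 ≤ a → 0 ≤ ω n a) → (∀ n, IsNormalMap (ω n)) →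
    Summable (fun n => ‖ω n‖ * ‖η n‖) →
    (∀ x ∈ s, ∑' n, ω n (mip M (η n) x) = 0) → ∀ x, ∑' n, ω n (mip M (η n) x) = 0

end Module

/-! ### Correspondences -/

/-- A C*-correspondence (`k = cstar`) or W*-correspondence (`k = wstar`) over `M`: a right Hilbert
`M`-module with a nondegenerate left action of `M` by adjointable operators. In the W*-setting it is
self-dual and the left action is normal. -/
structure AStarCorrespondence (k : AStarKind) (M : Type u) [NonUnitalCStarAlgebra M]
    [PartialOrder M] where
  carrier : Type v
  [normedAddCommGroup : NormedAddCommGroup carrier]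
  [normedSpace : NormedSpace ℂ carrier]
  [completeSpace : CompleteSpace carrier]
  [smul : SMul Mᵐᵒᵖ carrier]
  [cstarModule : CStarModule Mᵐᵒᵖ carrier]
  /-- the left action -/
  left : M →ₙₐ[ℂ] (carrier →L[ℂ] carrier)
  mip_left : ∀ (a : M) (x y : carrier), mip M (left a x) y = mip M x (left (star a) y)
  nondegenerate :
    (Submodule.span ℂ {z : carrier | ∃ a x, z = left a x}).topologicalClosure = ⊤
  selfDual : k = .wstar → IsSelfDual M carrier
  normal : k = .wstar → ∀ x : carrier, IsNormalMap fun a : M => mip M x (left a x)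

namespace AStarCorrespondence

instance (k : AStarKind) (M : Type u) [NonUnitalCStarAlgebra M] [PartialOrder M] :
    CoeSort (AStarCorrespondence.{u, v} k M) (Type v) := ⟨carrier⟩

attribute [instance] normedAddCommGroup normedSpace completeSpace smul cstarModule

end AStarCorrespondence

section Subproduct

variable {k : AStarKind} {M : Type u} [NonUnitalCStarAlgebra M] [PartialOrder M]

/-- The bilinear map `t : X × Y → Z` exhibits the correspondence `Z` as the (interior) tensor
product `X ⊗ Y`: the inner products of elementary tensors are
`⟨x ⊗ y, x' ⊗ y'⟩ = ⟨y, ⟨x, x'⟩ y'⟩`, the left action is `a (x ⊗ y) = (a x) ⊗ y`, and the elementary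
tensors are total: in norm in the C*-setting, and for the σ-topology in the W*-setting (where `Z`,
being self-dual, is then the self-dual extension of the C*-tensor product). This determines `Z` up
to a unique isomorphism of correspondences that respects elementary tensors. -/
structure IsInteriorTensorProduct {X Y Z : AStarCorrespondence.{u, v} k M}
    (t : X →ₗ[ℂ] Y →ₗ[ℂ] Z) : Prop where
  mip_tmul : ∀ x y x' y', mip M (t x y) (t x' y') = mip M y (Y.left (mip M x x') y')
  left_tmul : ∀ a x y, Z.left a (t x y) = t (X.left a x) y
  total_norm : k = .cstar →
    (Submodule.span ℂ {z : Z | ∃ x y, z = t x y}).topologicalClosure = ⊤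
  total_sigma : k = .wstar → IsSigmaTotal M {z : Z | ∃ x y, z = t x y}

/-- `U : K → Z` is a coisometric adjointable bimodule map: it respects the left actions and has an
adjoint `V` (which makes it a right module map) with `U V = 1`. -/
def IsCoisometricBimoduleMap {K Z : AStarCorrespondence.{u, v} k M} (U : K →L[ℂ] Z) : Prop :=
  (∀ a x, U (K.left a x) = Z.left a (U x)) ∧
  ∃ V : Z →L[ℂ] K, (∀ x z, mip M (U x) z = mip M x (V z)) ∧ ∀ z, U (V z) = z

/-- The bilinear map `μ : X × Y → Z` is of the form `(x, y) ↦ U (x ⊗ y)` with a coisometric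
adjointable bimodule map `U : X ⊗ Y → Z`. Through the isometry `U*`, this makes `Z` an orthogonally
complemented sub-bimodule of `X ⊗ Y`, and `U` the projection onto it. -/
def IsCoisometricProduct {X Y Z : AStarCorrespondence.{u, v} k M}
    (μ : X →ₗ[ℂ] Y →ₗ[ℂ] Z) : Prop :=
  ∃ (K : AStarCorrespondence.{u, v} k M) (t : X →ₗ[ℂ] Y →ₗ[ℂ] K) (U : K →L[ℂ] Z),
    IsInteriorTensorProduct t ∧ IsCoisometricBimoduleMap U ∧ ∀ x y, μ x y = U (t x y)

variable (k M) in
/-- A subproduct system `(X n)` over `M`: correspondences with `X 0 = M` and coisometric adjointable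
bimodule maps `U n m : X n ⊗ X m → X (n + m)`, given here through `mul n m x y = U n m (x ⊗ y)`,
that extend the actions of `M` and are associative. By means of the isometries `(U n m)*`, each
`X (n + m)` is an orthogonally complemented sub-bimodule of `X n ⊗ X m`, and `U n m` is the
projection onto it, so these are the standard subproduct systems. -/
structure SubproductSystem where
  X : ℕ → AStarCorrespondence.{u, v} k M
  /-- the identification of `M` with `X 0` as correspondences -/
  unit : M ≃ₗ[ℂ] X 0
  mip_unit : ∀ a b : M, mip M (unit a) (unit b) = star a * b
  left_unit : ∀ a b : M, (X 0).left a (unit b) = unit (a * b)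
  unit_right : ∀ a b : M, op b • unit a = unit (a * b)
  mul : ∀ n m, X n →ₗ[ℂ] X m →ₗ[ℂ] X (n + m)
  coisometric : ∀ n m, IsCoisometricProduct (mul n m)
  mul_unit : ∀ n (x : X n) (a : M), mul n 0 x (unit a) = op a • x
  unit_mul : ∀ n (a : M) (x : X n), HEq (mul 0 n (unit a) x) ((X n).left a x)
  mul_assoc : ∀ n m l (x : X n) (y : X m) (z : X l),
    HEq (mul (n + m) l (mul n m x y) z) (mul n (m + l) x (mul m l y z))

end Subproduct

/-- A representation of the A*-algebra `M` on the Hilbert space `E`: a nondegenerate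
*-homomorphism into `B(E)`, which is normal in the W*-setting. -/
structure AStarRep (k : AStarKind) (M : Type u) [NonUnitalCStarAlgebra M] [PartialOrder M]
    (E : Type w) [NormedAddCommGroup E] [InnerProductSpace ℂ E] [CompleteSpace E] where
  toHom : M →⋆ₙₐ[ℂ] (E →L[ℂ] E)
  nondegenerate : (Submodule.span ℂ {z : E | ∃ a h, z = toHom a h}).topologicalClosure = ⊤
  normal : k = .wstar → IsNormalMap toHom

/-! ### The Hilbert space `X ⊗_ψ E` -/

section Positivity

variable {M : Type u} [NonUnitalCStarAlgebra M] [PartialOrder M] [StarOrderedRing M]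
  {E : Type w} [NormedAddCommGroup E] [InnerProductSpace ℂ E] [CompleteSpace E]

/-- A selfadjoint element is a difference of two orthogonal squares of selfadjoint elements. -/
lemma exists_sq_sub_sq {A : Type*} [NonUnitalCStarAlgebra A] (T : A) (hT : IsSelfAdjoint T) :
    ∃ r s : A, IsSelfAdjoint r ∧ IsSelfAdjoint s ∧ r * r - s * s = T ∧ s * r = 0 := by
  refine ⟨cfcₙ (fun x : ℝ => √(x⁺)) T, cfcₙ (fun x : ℝ => √(x⁻)) T, cfcₙ_predicate _ _,
    cfcₙ_predicate _ _, ?_, ?_⟩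
  · rw [← cfcₙ_mul (fun x : ℝ => √(x⁺)) (fun x : ℝ => √(x⁺)) T (by fun_prop) (by simp)
      (by fun_prop) (by simp),
      ← cfcₙ_mul (fun x : ℝ => √(x⁻)) (fun x : ℝ => √(x⁻)) T (by fun_prop) (by simp)
      (by fun_prop) (by simp), ← cfcₙ_sub _ _ T (by fun_prop) (by simp) (by fun_prop) (by simp)]
    conv_rhs => rw [← cfcₙ_id' ℝ T]
    congr 1
    ext x
    rw [Real.mul_self_sqrt (posPart_nonneg x), Real.mul_self_sqrt (negPart_nonneg x),
      posPart_sub_negPart]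
  · rw [← cfcₙ_mul (fun x : ℝ => √(x⁻)) (fun x : ℝ => √(x⁺)) T (by fun_prop) (by simp)
      (by fun_prop) (by simp)]
    have : (fun x : ℝ => √(x⁻) * √(x⁺)) = fun _ => 0 := by
      ext x
      rcases le_total 0 x with h | h
      · simp [negPart_eq_zero.2 h]
      · simp [posPart_eq_zero.2 h]
    rw [this, cfcₙ_const_zero]

/-- A selfadjoint matrix over `M` with nonnegative quadratic form is of the form `R* R`. -/
lemma exists_sq_of_form_nonneg {ι : Type*} [Fintype ι] (G : ι → ι → M)
    (hG : ∀ i j, star (G i j) = G j i)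
    (hpos : ∀ a : ι → M, 0 ≤ ∑ i, ∑ j, star (a i) * G i j * a j) :
    ∃ R : ι → ι → M, ∀ i j, G i j = ∑ l, star (R l i) * R l j := by
  classical
  set T : CStarMatrix ι ι M := CStarMatrix.ofMatrix (Matrix.of G) with hT
  have hTsa : IsSelfAdjoint T := by
    ext i j
    exact hG j i
  obtain ⟨r, s, hr, hs, hrs, hrs0⟩ := exists_sq_sub_sq T hTsa
  have key : s * T * s = - ((s * s) * (s * s)) := by
    rw [← hrs]
    simp only [mul_sub, ← mul_assoc, hrs0, zero_mul, zero_sub, neg_mul]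
  have hss : s * s = 0 := by
    ext i j
    have h1 : (s * T * s) j j = ∑ i, ∑ l, star (s i j) * G i l * s l j := by
      have hst : ∀ p q, s p q = star (s q p) := fun p q => by
        have := congrFun (congrFun hs p) q
        exact this.symm
      simp only [CStarMatrix.mul_apply, Finset.sum_mul]
      rw [Finset.sum_comm]
      refine Finset.sum_congr rfl fun p _ => Finset.sum_congr rfl fun q _ => ?_
      rw [hst j p]; rfl
    have h2 : ((s * s) * (s * s)) j j = ∑ l, star ((s * s) l j) * (s * s) l j := by
      have hss' : IsSelfAdjoint (s * s) := by
        rw [IsSelfAdjoint, star_mul, hs.star_eq]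
      rw [CStarMatrix.mul_apply]
      refine Finset.sum_congr rfl fun p _ => ?_
      congr 1
      exact (congrFun (congrFun hss' j) p).symm
    have h3 : 0 ≤ (s * T * s) j j := by rw [h1]; exact hpos fun l => s l j
    rw [key, CStarMatrix.neg_apply, h2] at h3
    have h4 : ∑ l, star ((s * s) l j) * (s * s) l j = 0 :=
      le_antisymm (by simpa using h3) (Finset.sum_nonneg fun _ _ => star_mul_self_nonneg _)
    have h5 := (Finset.sum_eq_zero_iff_of_nonneg fun _ _ => star_mul_self_nonneg _).1 h4 i
      (Finset.mem_univ _)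
    exact (CStarRing.star_mul_self_eq_zero_iff _).1 h5
  refine ⟨fun i j => r i j, fun i j => ?_⟩
  have h6 : T i j = (r * r) i j := by rw [← hrs, hss, sub_zero]
  change T i j = _
  rw [h6, CStarMatrix.mul_apply]
  refine Finset.sum_congr rfl fun p _ => ?_
  congr 1
  exact (congrFun (congrFun hr i) p).symm

lemma form_rep_nonneg (ψ : M →⋆ₙₐ[ℂ] (E →L[ℂ] E)) {ι : Type*} [Fintype ι] (G : ι → ι → M)
    (hG : ∀ i j, star (G i j) = G j i)
    (hpos : ∀ a : ι → M, 0 ≤ ∑ i, ∑ j, star (a i) * G i j * a j) (h : ι → E) :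
    0 ≤ ∑ i, ∑ j, inner ℂ (h i) (ψ (G i j) (h j)) := by
  obtain ⟨R, hR⟩ := exists_sq_of_form_nonneg G hG hpos
  have : ∑ i, ∑ j, inner ℂ (h i) (ψ (G i j) (h j)) =
      ∑ l, inner ℂ (∑ i, ψ (R l i) (h i)) (∑ i, ψ (R l i) (h i)) := by
    have h1 : ∀ i j, inner ℂ (h i) (ψ (G i j) (h j)) =
        ∑ l, inner ℂ (ψ (R l i) (h i)) (ψ (R l j) (h j)) := fun i j => by
      rw [hR, map_sum, sum_apply, inner_sum]
      refine Finset.sum_congr rfl fun l _ => ?_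
      rw [map_mul, map_star, ContinuousLinearMap.star_eq_adjoint,
        ← ContinuousLinearMap.adjoint_inner_right]
      rfl
    simp only [h1, sum_inner, inner_sum]
    calc _ = ∑ i, ∑ l, ∑ j, inner ℂ (ψ (R l i) (h i)) (ψ (R l j) (h j)) :=
          Finset.sum_congr rfl fun i _ => Finset.sum_comm
      _ = ∑ l, ∑ i, ∑ j, inner ℂ (ψ (R l i) (h i)) (ψ (R l j) (h j)) := Finset.sum_comm
      _ = _ := Finset.sum_congr rfl fun l _ => Finset.sum_comm
  rw [this]
  refine Finset.sum_nonneg fun l _ => ?_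
  rw [inner_self_eq_norm_sq_to_K]
  positivity

end Positivity

section HilbertTensor

variable {M : Type u} [NonUnitalCStarAlgebra M] [PartialOrder M]
  {X : Type v} [NormedAddCommGroup X] [NormedSpace ℂ X] [SMul Mᵐᵒᵖ X] [CStarModule Mᵐᵒᵖ X]
  {Y : Type v} [NormedAddCommGroup Y] [NormedSpace ℂ Y] [SMul Mᵐᵒᵖ Y] [CStarModule Mᵐᵒᵖ Y]
  {E : Type w} [NormedAddCommGroup E] [InnerProductSpace ℂ E] [CompleteSpace E]

variable (X) in
/-- The sesquilinear form on the algebraic tensor product `X ⊗ E` with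
`⟨x ⊗ h, x' ⊗ h'⟩ = ⟨h, ψ(⟨x, x'⟩) h'⟩`. -/
def tensorForm (ψ : M →⋆ₙₐ[ℂ] (E →L[ℂ] E)) : X ⊗[ℂ] E →ₗ⋆[ℂ] X ⊗[ℂ] E →ₗ[ℂ] ℂ :=
  TensorProduct.lift <| LinearMap.mk₂'ₛₗ (starRingEnd ℂ) (starRingEnd ℂ)
    (fun (x : X) (h : E) => TensorProduct.lift <| LinearMap.mk₂ ℂ
      (fun (x' : X) (h' : E) => inner ℂ h (ψ (mip M x x') h'))
      (fun a b c => by simp [mip_add_right])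
      (fun a b c => by simp [mip_smul_right])
      (fun a b c => by simp)
      (fun a b c => by simp))
    (fun a b c => by ext; simp [mip_add_left])
    (fun a b c => by ext; simp [mip_smul_left])
    (fun a b c => by ext; simp)
    (fun a b c => by ext; simp [mul_comm])

@[simp] lemma tensorForm_tmul (ψ : M →⋆ₙₐ[ℂ] (E →L[ℂ] E)) (x x' : X) (h h' : E) :
    tensorForm X ψ (x ⊗ₜ h) (x' ⊗ₜ h') = inner ℂ h (ψ (mip M x x') h') := rfl

/-- Every algebraic tensor is a finite sum of elementary ones. -/
lemma exists_sum_tmul {X : Type v} {E : Type w} [AddCommGroup X] [Module ℂ X] [AddCommGroup E]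
    [Module ℂ E] (z : X ⊗[ℂ] E) :
    ∃ (n : ℕ) (x : Fin n → X) (h : Fin n → E), z = ∑ i, x i ⊗ₜ[ℂ] h i := by
  induction z with
  | zero => exact ⟨0, Fin.elim0, Fin.elim0, by simp⟩
  | tmul x h => exact ⟨1, fun _ => x, fun _ => h, by simp⟩
  | add a b ha hb =>
    obtain ⟨n, x, h, rfl⟩ := ha
    obtain ⟨m, x', h', rfl⟩ := hb
    refine ⟨n + m, Fin.append x x', Fin.append h h', ?_⟩
    simp [Fin.sum_univ_add]

lemma tensorForm_conj_symm (ψ : M →⋆ₙₐ[ℂ] (E →L[ℂ] E)) (z z' : X ⊗[ℂ] E) :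
    starRingEnd ℂ (tensorForm X ψ z' z) = tensorForm X ψ z z' := by
  induction z with
  | zero => simp
  | add a b ha hb => simp [ha, hb]
  | tmul x h =>
    induction z' with
    | zero => simp
    | add a b ha hb => simp [ha, hb]
    | tmul x' h' =>
      rw [tensorForm_tmul, tensorForm_tmul, inner_conj_symm, ← star_mip x x', map_star,
        ContinuousLinearMap.star_eq_adjoint, ContinuousLinearMap.adjoint_inner_left]

variable [StarOrderedRing M]

/-- If `L : X → Y` is a module map with `⟨L x, L x⟩ ≤ C² ⟨x, x⟩`, then `L ⊗ 1` is bounded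
by `C`. -/
lemma tensorForm_map_le (ψ : M →⋆ₙₐ[ℂ] (E →L[ℂ] E)) (L : X →ₗ[ℂ] Y) (C : ℝ)
    (hL : ∀ (a : M) (x : X), L (op a • x) = op a • L x)
    (hC : ∀ x, mip M (L x) (L x) ≤ ((C ^ 2 : ℝ) : ℂ) • mip M x x) (z : X ⊗[ℂ] E) :
    tensorForm Y ψ (L.rTensor E z) (L.rTensor E z) ≤ ((C ^ 2 : ℝ) : ℂ) * tensorForm X ψ z z := by
  obtain ⟨n, x, h, rfl⟩ := exists_sum_tmul z
  have key := form_rep_nonneg ψ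
    (fun i j => ((C ^ 2 : ℝ) : ℂ) • mip M (x i) (x j) - mip M (L (x i)) (L (x j)))
    (fun i j => by simp [star_mip]) (fun a => by
      have h1 := hC (∑ i, op (a i) • x i)
      rw [← sub_nonneg] at h1
      convert h1 using 1
      simp only [map_sum, hL, mip_sum_left, mip_sum_right, mip_op_left, mip_op_right,
        Finset.smul_sum, Finset.sum_mul, ← Finset.sum_sub_distrib]
      rw [Finset.sum_comm]
      refine Finset.sum_congr rfl fun i _ => Finset.sum_congr rfl fun j _ => ?_
      rw [mul_sub, sub_mul, mul_smul_comm, smul_mul_assoc]) h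
  rw [← sub_nonneg]
  convert key using 1
  simp only [map_sum, LinearMap.sum_apply, LinearMap.rTensor_tmul, tensorForm_tmul, Finset.mul_sum,
    ← Finset.sum_sub_distrib]
  rw [Finset.sum_comm]
  refine Finset.sum_congr rfl fun i _ => Finset.sum_congr rfl fun j _ => ?_
  simp

lemma tensorForm_self_nonneg (ψ : M →⋆ₙₐ[ℂ] (E →L[ℂ] E)) (z : X ⊗[ℂ] E) :
    0 ≤ tensorForm X ψ z z := by
  have := tensorForm_map_le (Y := X) ψ (0 : X →ₗ[ℂ] X) 1 (fun a x => by
      refine mip_ext (M := M) fun z => ?_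
      simp [mip]) (fun x => by simpa [mip] using mip_self_nonneg x) z
  simpa using this

set_option linter.unusedVariables false in
variable (X) in
/-- The algebraic tensor product `X ⊗ E` with the seminorm coming from `tensorForm X ψ`. -/
def PreTensor (ψ : M →⋆ₙₐ[ℂ] (E →L[ℂ] E)) : Type (max v w) := X ⊗[ℂ] E

instance (ψ : M →⋆ₙₐ[ℂ] (E →L[ℂ] E)) : AddCommGroup (PreTensor X ψ) :=
  inferInstanceAs (AddCommGroup (X ⊗[ℂ] E))

instance (ψ : M →⋆ₙₐ[ℂ] (E →L[ℂ] E)) : Module ℂ (PreTensor X ψ) :=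
  inferInstanceAs (Module ℂ (X ⊗[ℂ] E))

variable (X) in
/-- The algebraic tensor product, as a `PreTensor`. -/
def toPreTensor (ψ : M →⋆ₙₐ[ℂ] (E →L[ℂ] E)) : X ⊗[ℂ] E ≃ₗ[ℂ] PreTensor X ψ :=
  LinearEquiv.refl ℂ _

variable (X) in
abbrev preTensorCore (ψ : M →⋆ₙₐ[ℂ] (E →L[ℂ] E)) :
    PreInnerProductSpace.Core ℂ (PreTensor X ψ) where
  inner z z' := tensorForm X ψ ((toPreTensor X ψ).symm z) ((toPreTensor X ψ).symm z')
  conj_inner_symm _ _ := tensorForm_conj_symm ψ _ _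
  re_inner_nonneg _ := (RCLike.nonneg_iff.mp (tensorForm_self_nonneg ψ _)).1
  add_left _ _ _ := by simp
  smul_left _ _ _ := by simp

instance (ψ : M →⋆ₙₐ[ℂ] (E →L[ℂ] E)) : SeminormedAddCommGroup (PreTensor X ψ) :=
  InnerProductSpace.Core.toSeminormedAddCommGroup (c := preTensorCore X ψ)

instance (ψ : M →⋆ₙₐ[ℂ] (E →L[ℂ] E)) : InnerProductSpace ℂ (PreTensor X ψ) :=
  InnerProductSpace.ofCore (preTensorCore X ψ)

lemma preTensor_inner (ψ : M →⋆ₙₐ[ℂ] (E →L[ℂ] E)) (z z' : PreTensor X ψ) :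
    inner ℂ z z' = tensorForm X ψ ((toPreTensor X ψ).symm z) ((toPreTensor X ψ).symm z') := rfl

variable (X) in
/-- The Hilbert space `X ⊗_ψ E`: the (Hausdorff) completion of the algebraic tensor product for
`⟨x ⊗ h, x' ⊗ h'⟩ = ⟨h, ψ(⟨x, x'⟩) h'⟩`. -/
abbrev HilbertTensor (ψ : M →⋆ₙₐ[ℂ] (E →L[ℂ] E)) : Type (max v w) :=
  UniformSpace.Completion (PreTensor X ψ)

/-- The elementary tensor `x ⊗ h` in `X ⊗_ψ E`. -/
def htmul (ψ : M →⋆ₙₐ[ℂ] (E →L[ℂ] E)) (x : X) (h : E) : HilbertTensor X ψ :=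
  ((toPreTensor X ψ (x ⊗ₜ h) : PreTensor X ψ) : UniformSpace.Completion (PreTensor X ψ))

lemma inner_htmul (ψ : M →⋆ₙₐ[ℂ] (E →L[ℂ] E)) (x x' : X) (h h' : E) :
    inner ℂ (htmul ψ x h) (htmul ψ x' h') = inner ℂ h (ψ (mip M x x') h') := by
  rw [htmul, htmul, UniformSpace.Completion.inner_coe]; rfl

/-- `L ⊗ 1` on the algebraic tensor product. -/
def preTensorMap (ψ : M →⋆ₙₐ[ℂ] (E →L[ℂ] E)) (L : X →ₗ[ℂ] Y) (C : ℝ) (hC0 : 0 ≤ C)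
    (hL : ∀ (a : M) (x : X), L (op a • x) = op a • L x)
    (hC : ∀ x, mip M (L x) (L x) ≤ ((C ^ 2 : ℝ) : ℂ) • mip M x x) :
    PreTensor X ψ →L[ℂ] PreTensor Y ψ :=
  ((toPreTensor Y ψ).toLinearMap ∘ₗ L.rTensor E ∘ₗ
    (toPreTensor X ψ).symm.toLinearMap).mkContinuous C fun z => by
      rw [← sq_le_sq₀ (norm_nonneg _) (by positivity), mul_pow,
        ← inner_self_eq_norm_sq (𝕜 := ℂ), ← inner_self_eq_norm_sq (𝕜 := ℂ)]
      have := (Complex.le_def.1 (tensorForm_map_le ψ L C hL hC ((toPreTensor X ψ).symm z))).1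
      rw [Complex.re_ofReal_mul] at this
      exact this

/-- The bounded operator `L ⊗ 1 : X ⊗_ψ E → Y ⊗_ψ E` of a module map `L : X → Y` with
`⟨L x, L x⟩ ≤ C² ⟨x, x⟩`. -/
def hilbertTensorMap (ψ : M →⋆ₙₐ[ℂ] (E →L[ℂ] E)) (L : X →ₗ[ℂ] Y) (C : ℝ) (hC0 : 0 ≤ C)
    (hL : ∀ (a : M) (x : X), L (op a • x) = op a • L x)
    (hC : ∀ x, mip M (L x) (L x) ≤ ((C ^ 2 : ℝ) : ℂ) • mip M x x) :
    HilbertTensor X ψ →L[ℂ] HilbertTensor Y ψ :=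
  (preTensorMap ψ L C hC0 hL hC).completion

lemma hilbertTensorMap_htmul (ψ : M →⋆ₙₐ[ℂ] (E →L[ℂ] E)) (L : X →ₗ[ℂ] Y) (C : ℝ) (hC0 : 0 ≤ C)
    (hL : ∀ (a : M) (x : X), L (op a • x) = op a • L x)
    (hC : ∀ x, mip M (L x) (L x) ≤ ((C ^ 2 : ℝ) : ℂ) • mip M x x) (x : X) (h : E) :
    hilbertTensorMap ψ L C hC0 hL hC (htmul ψ x h) = htmul ψ (L x) h := by
  rw [hilbertTensorMap, htmul, ContinuousLinearMap.completion_apply_coe]; rfl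

lemma norm_hilbertTensorMap_le (ψ : M →⋆ₙₐ[ℂ] (E →L[ℂ] E)) (L : X →ₗ[ℂ] Y) (C : ℝ) (hC0 : 0 ≤ C)
    (hL : ∀ (a : M) (x : X), L (op a • x) = op a • L x)
    (hC : ∀ x, mip M (L x) (L x) ≤ ((C ^ 2 : ℝ) : ℂ) • mip M x x) (z : HilbertTensor X ψ) :
    ‖hilbertTensorMap ψ L C hC0 hL hC z‖ ≤ C * ‖z‖ := by
  induction z using UniformSpace.Completion.induction_on with
  | hp => exact isClosed_le (by fun_prop) (by fun_prop)
  | ih z =>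
    rw [hilbertTensorMap, ContinuousLinearMap.completion_apply_coe,
      UniformSpace.Completion.norm_coe, UniformSpace.Completion.norm_coe]
    exact ((preTensorMap ψ L C hC0 hL hC).le_of_opNorm_le (LinearMap.mkContinuous_norm_le _ hC0 _) z)

end HilbertTensor

/-! ### The Fock space and the shift -/

/-- In a C*-algebra, `‖a‖ - a` is a square up to the missing unit, for selfadjoint `a`. -/
lemma exists_norm_sub_sq {A : Type*} [NonUnitalCStarAlgebra A] (a : A) (ha : IsSelfAdjoint a) :
    ∃ c : A, IsSelfAdjoint c ∧ (2 * √‖a‖) • c - c * c = a := by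
  have hc1 : ContinuousOn (fun x : ℝ => √‖a‖ - √(‖a‖ - x)) (quasispectrum ℝ a) := by fun_prop
  refine ⟨cfcₙ (fun x : ℝ => √‖a‖ - √(‖a‖ - x)) a, cfcₙ_predicate _ _, ?_⟩
  rw [← cfcₙ_smul _ _ a hc1 (by simp), ← cfcₙ_mul _ _ a hc1 (by simp) hc1 (by simp),
    ← cfcₙ_sub _ _ a (by fun_prop) (by simp) (by fun_prop) (by simp)]
  conv_rhs => rw [← cfcₙ_id' ℝ a]
  refine cfcₙ_congr fun x hx => ?_
  have h1 : ‖x‖ ≤ ‖a‖ := by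
    have := norm_apply_le_norm_cfcₙ (fun x : ℝ => x) a hx
    rwa [cfcₙ_id' ℝ a] at this
  have h2 : 0 ≤ ‖a‖ - x := sub_nonneg.2 ((le_abs_self x).trans h1)
  have h3 := Real.mul_self_sqrt h2
  have h4 := Real.mul_self_sqrt (norm_nonneg a)
  simp only [smul_eq_mul]
  nlinarith

namespace AStarCorrespondence

variable {k : AStarKind} {M : Type u} [NonUnitalCStarAlgebra M] [PartialOrder M]
  [StarOrderedRing M]

lemma mip_left_le (X : AStarCorrespondence.{u, v} k M) (a : M) (ha : IsSelfAdjoint a) (x : X) :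
    mip M x (X.left a x) ≤ (‖a‖ : ℂ) • mip M x x := by
  obtain ⟨c, hc, hca⟩ := exists_norm_sub_sq a ha
  have hca' : a = ((2 * √‖a‖ : ℝ) : ℂ) • c - c * c := by rw [Complex.coe_smul, hca]
  rw [← sub_nonneg]
  have h1 := mip_self_nonneg (M := M) (((√‖a‖ : ℝ) : ℂ) • x - X.left c x)
  convert h1 using 1
  have h2 : ((‖a‖ : ℝ) : ℂ) = ((√‖a‖ : ℝ) : ℂ) * ((√‖a‖ : ℝ) : ℂ) := by
    rw [← Complex.ofReal_mul, Real.mul_self_sqrt (norm_nonneg a)]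
  have h3 : X.left a x = ((2 * √‖a‖ : ℝ) : ℂ) • X.left c x - X.left c (X.left c x) := by
    conv_lhs => rw [hca']
    rw [map_sub, map_smul, map_mul]; rfl
  rw [h3, h2]
  simp only [mip_sub_left, mip_sub_right, mip_smul_left, mip_smul_right, X.mip_left, hc.star_eq,
    Complex.ofReal_mul, Complex.ofReal_ofNat, RCLike.star_def, Complex.conj_ofReal]
  module

end AStarCorrespondence

namespace IsInteriorTensorProduct

variable {k : AStarKind} {M : Type u} [NonUnitalCStarAlgebra M] [PartialOrder M]
  {X Y Z : AStarCorrespondence.{u, v} k M} {t : X →ₗ[ℂ] Y →ₗ[ℂ] Z}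

lemma tmul_op (ht : IsInteriorTensorProduct t) (x : X) (y : Y) (a : M) :
    t x (op a • y) = op a • t x y := by
  have h1 : ∀ y', mip M (t x (op a • y) - op a • t x y) (t x y') = 0 := fun y' => by
    rw [mip_sub_left, mip_op_left, ht.mip_tmul, ht.mip_tmul, mip_op_left, sub_self]
  have h2 : mip M (t x (op a • y) - op a • t x y) (t x (op a • y) - op a • t x y) = 0 := by
    rw [mip_sub_right, mip_op_right, h1, h1, zero_mul, sub_self]
  exact sub_eq_zero.1 (CStarModule.inner_self.1 (unop_injective h2 : inner Mᵐᵒᵖ _ _ = 0))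

lemma tmul_le [StarOrderedRing M] (ht : IsInteriorTensorProduct t) (x : X) (y : Y) :
    mip M (t x y) (t x y) ≤ ((‖x‖ ^ 2 : ℝ) : ℂ) • mip M y y := by
  rw [ht.mip_tmul, ← norm_mip_self (M := M)]
  exact Y.mip_left_le _ (star_mip x x) y

end IsInteriorTensorProduct

namespace SubproductSystem

variable {k : AStarKind} {M : Type u} [NonUnitalCStarAlgebra M] [PartialOrder M]
  (S : SubproductSystem.{u, v} k M)

/-- The creation operator `η ↦ U n m (ζ ⊗ η)` from `X m` to `X l`, where `l = n + m`. -/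
def creation {n m l : ℕ} (h : n + m = l) (ζ : S.X n) : S.X m →ₗ[ℂ] S.X l :=
  h ▸ S.mul n m ζ

lemma creation_op {n m l : ℕ} (h : n + m = l) (ζ : S.X n) (a : M) (η : S.X m) :
    S.creation h ζ (op a • η) = op a • S.creation h ζ η := by
  subst h
  obtain ⟨K, t, U, ht, ⟨-, V, hV, -⟩, hU⟩ := S.coisometric n m
  change S.mul n m ζ _ = op a • S.mul n m ζ _
  refine mip_ext (M := M) fun z => ?_
  rw [hU, hU, ht.tmul_op, ← star_mip, hV, star_mip, mip_op_right, mip_op_right, ← star_mip (U _),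
    hV, star_mip]

variable [StarOrderedRing M]

lemma creation_le {n m l : ℕ} (h : n + m = l) (ζ : S.X n) (η : S.X m) :
    mip M (S.creation h ζ η) (S.creation h ζ η) ≤ ((‖ζ‖ ^ 2 : ℝ) : ℂ) • mip M η η := by
  subst h
  obtain ⟨K, t, U, ht, ⟨-, V, hV, hUV⟩, hU⟩ := S.coisometric n m
  change mip M (S.mul n m ζ η) (S.mul n m ζ η) ≤ _
  refine le_trans ?_ (ht.tmul_le ζ η)
  rw [hU, ← sub_nonneg]
  have h1 := mip_self_nonneg (M := M) (t ζ η - V (U (t ζ η)))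
  convert h1 using 1
  rw [mip_sub_left, mip_sub_right, mip_sub_right, ← hV, ← hV, hUV,
    ← star_mip (t ζ η) (V (U (t ζ η))), ← hV, star_mip]
  abel

variable {E : Type w} [NormedAddCommGroup E] [InnerProductSpace ℂ E] [CompleteSpace E]

/-- The Hilbert space `F_X ⊗_ψ E`, where `F_X = ⨁ₙ X n` is the Fock space. Since interior tensor
products commute with direct sums, it is the Hilbert space direct sum of the `X n ⊗_ψ E`: the
elementary tensor `(xₙ)ₙ ⊗ h` is the family `(xₙ ⊗ h)ₙ`. -/
abbrev FockTensor (ψ : AStarRep k M E) : Type (max v w) :=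
  lp (fun n => HilbertTensor (S.X n) ψ.toHom) 2

/-- The operator `η ⊗ h ↦ U n m (ζ ⊗ η) ⊗ h` from `X m ⊗_ψ E` to `X l ⊗_ψ E`, `l = n + m`. -/
def creationTensor (ψ : AStarRep k M E) {n m l : ℕ} (h : n + m = l) (ζ : S.X n) :
    HilbertTensor (S.X m) ψ.toHom →L[ℂ] HilbertTensor (S.X l) ψ.toHom :=
  hilbertTensorMap ψ.toHom (S.creation h ζ) ‖ζ‖ (norm_nonneg ζ) (S.creation_op h ζ)
    (S.creation_le h ζ)

/-- The components of `(S_n(ζ) ⊗ 1) ξ`. -/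
def shiftFun (ψ : AStarRep k M E) {n : ℕ} (ζ : S.X n) (ξ : S.FockTensor ψ) (l : ℕ) :
    HilbertTensor (S.X l) ψ.toHom :=
  if h : n ≤ l then S.creationTensor ψ (Nat.add_sub_cancel' h) ζ (ξ (l - n)) else 0

lemma shiftFun_of_eq (ψ : AStarRep k M E) {n : ℕ} (ζ : S.X n) (ξ : S.FockTensor ψ) {m l : ℕ}
    (h : n + m = l) : S.shiftFun ψ ζ ξ l = S.creationTensor ψ h ζ (ξ m) := by
  obtain rfl : m = l - n := by omega
  rw [shiftFun, dif_pos (by omega)]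

lemma norm_shiftFun_le (ψ : AStarRep k M E) {n : ℕ} (ζ : S.X n) (ξ : S.FockTensor ψ) (m : ℕ) :
    ‖S.shiftFun ψ ζ ξ (m + n)‖ ≤ ‖ζ‖ * ‖ξ m‖ := by
  rw [S.shiftFun_of_eq ψ ζ ξ (add_comm n m)]
  exact norm_hilbertTensorMap_le _ _ _ _ _ _ _

lemma summable_shiftFun (ψ : AStarRep k M E) {n : ℕ} (ζ : S.X n) (ξ : S.FockTensor ψ) :
    Summable fun l => ‖S.shiftFun ψ ζ ξ l‖ ^ 2 := by
  rw [← summable_nat_add_iff n]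
  have h1 : Summable fun m => ‖ξ m‖ ^ 2 := by
    simpa using (lp.memℓp ξ).summable (by simp)
  refine Summable.of_nonneg_of_le (fun _ => by positivity) (fun m => ?_) (h1.mul_left (‖ζ‖ ^ 2))
  rw [← mul_pow]
  exact pow_le_pow_left₀ (norm_nonneg _) (S.norm_shiftFun_le ψ ζ ξ m) 2

lemma tsum_shiftFun_le (ψ : AStarRep k M E) {n : ℕ} (ζ : S.X n) (ξ : S.FockTensor ψ) :
    ∑' l, ‖S.shiftFun ψ ζ ξ l‖ ^ 2 ≤ ‖ζ‖ ^ 2 * ∑' m, ‖ξ m‖ ^ 2 := by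
  have h1 : Summable fun m => ‖ξ m‖ ^ 2 := by
    simpa using (lp.memℓp ξ).summable (by simp)
  have hs := S.summable_shiftFun ψ ζ ξ
  rw [← hs.sum_add_tsum_nat_add n, Finset.sum_eq_zero, zero_add, ← tsum_mul_left]
  · refine Summable.tsum_le_tsum (fun m => ?_) ((summable_nat_add_iff n).2 hs) (h1.mul_left _)
    rw [← mul_pow]
    exact pow_le_pow_left₀ (norm_nonneg _) (S.norm_shiftFun_le ψ ζ ξ m) 2
  · intro l hl
    rw [shiftFun, dif_neg (by simpa using hl)]
    simp

/-- The induced shift `S_n(ζ) ⊗ 1` on `F_X ⊗_ψ E`, which maps the elementary tensor `η ⊗ h` of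
degree `m` to the elementary tensor `U n m (ζ ⊗ η) ⊗ h` of degree `n + m`. -/
def shift (ψ : AStarRep k M E) {n : ℕ} (ζ : S.X n) : S.FockTensor ψ →L[ℂ] S.FockTensor ψ :=
  LinearMap.mkContinuous
    { toFun := fun ξ => ⟨S.shiftFun ψ ζ ξ, memℓp_gen (by simpa using S.summable_shiftFun ψ ζ ξ)⟩
      map_add' := fun ξ ξ' => by
        ext l
        change S.shiftFun ψ ζ (ξ + ξ') l = S.shiftFun ψ ζ ξ l + S.shiftFun ψ ζ ξ' l
        unfold shiftFun
        split_ifs <;> simp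
      map_smul' := fun c ξ => by
        ext l
        change S.shiftFun ψ ζ (c • ξ) l = c • S.shiftFun ψ ζ ξ l
        unfold shiftFun
        split_ifs <;> simp }
    ‖ζ‖ fun ξ => by
      rw [← sq_le_sq₀ (norm_nonneg _) (by positivity), mul_pow]
      have h2 : ∀ ξ : S.FockTensor ψ, ‖ξ‖ ^ 2 = ∑' m, ‖ξ m‖ ^ 2 := fun ξ => by
        simpa using lp.norm_rpow_eq_tsum (p := 2) (by simp) ξ
      rw [h2, h2]
      exact S.tsum_shiftFun_le ψ ζ ξ

lemma shift_single (ψ : AStarRep k M E) {n : ℕ} (ζ : S.X n) (m : ℕ) (η : S.X m) (h : E) :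
    S.shift ψ ζ (lp.single 2 m (htmul ψ.toHom η h)) =
      lp.single 2 (n + m) (htmul ψ.toHom (S.mul n m ζ η) h) := by
  ext l
  change S.shiftFun ψ ζ _ l = _
  by_cases hl : n ≤ l
  · obtain ⟨j, rfl⟩ := Nat.exists_eq_add_of_le hl
    rw [S.shiftFun_of_eq ψ ζ _ rfl]
    by_cases hj : j = m
    · subst hj
      simp only [lp.single_apply_self]
      exact hilbertTensorMap_htmul _ _ _ _ _ _ _ _
    · rw [lp.single_apply_ne _ _ _ hj, lp.single_apply_ne _ _ _ (by omega), map_zero]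
  · rw [shiftFun, dif_neg hl, lp.single_apply_ne _ _ _ (by omega)]

/-- A subspace of `F_X ⊗_ψ E` is invariant for the induced shift if it is mapped into itself by all
`S_n(ζ) ⊗ 1`, `n ≥ 0`. As `X 0 = M`, the operators with `n = 0` are those by which `M` acts on the
left of `F_X ⊗_ψ E`. -/
def IsShiftInvariant (ψ : AStarRep k M E) (W : Submodule ℂ (S.FockTensor ψ)) : Prop :=
  ∀ (n : ℕ) (ζ : S.X n), ∀ ξ ∈ W, S.shift ψ ζ ξ ∈ W

/-- A bounded operator `Π : F_X ⊗_π E' → F_X ⊗_ψ E` is multi-analytic if it intertwines the induced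
shifts. -/
def IsMultiAnalytic {E' : Type*} [NormedAddCommGroup E'] [InnerProductSpace ℂ E']
    [CompleteSpace E'] (π : AStarRep k M E') (ψ : AStarRep k M E)
    (P : S.FockTensor π →L[ℂ] S.FockTensor ψ) : Prop :=
  ∀ (n : ℕ) (ζ : S.X n), P ∘L S.shift π ζ = S.shift ψ ζ ∘L P

end SubproductSystem

/-- A bounded operator between Hilbert spaces is a partial isometry if it is isometric on the
orthogonal complement of its kernel. -/
def IsPartialIsometry {H K : Type*} [NormedAddCommGroup H] [InnerProductSpace ℂ H]
    [NormedAddCommGroup K] [InnerProductSpace ℂ K] (P : H →L[ℂ] K) : Prop :=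
  ∀ x ∈ (LinearMap.ker P.toLinearMap)ᗮ, ‖P x‖ = ‖x‖

end

/-!
# Invariant subspaces of the shift of a subproduct system

The range of an operator that intertwines the shifts is invariant, so the content is the converse.
Let `W` be a closed invariant subspace of `F_X ⊗_ψ E`. The restrictions `T_n(ζ)` of the operators
`S_n(ζ) ⊗ 1` to `W` form a covariant representation of the subproduct system on `W`
(`IsCovariantRep`), with the representation `π` of `M` that is given by `n = 0`, and the operators
`T_n : X n ⊗_π W → W`, `ζ ⊗ w ↦ T_n(ζ) w`, are contractions. Put `Δ = (1 - T_1 T_1*)^(1/2)`. The inner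
operator is the Poisson transform `η ⊗ w ↦ T_m(η) Δ w`, with `E' = W`: it is multi-analytic since `T`
is multiplicative, and it is a coisometry onto `W` since
`∑ T_n (1 ⊗ Δ²) T_n* = ∑ (T_n T_n* - T_{n+1} T_{n+1}*)` telescopes to `T_0 T_0* = 1`
(`IsCovariantRep.exists_poisson`). Three facts enter.

* `T_{n+1} T_{n+1}* = T_n (1 ⊗ T_1 T_1*) T_n*` (`IsCovariantRep.rangeOp_succ`), as
  `ζ ⊗ (η ⊗ w) ↦ U(ζ ⊗ η) ⊗ w` is a coisometry from `X n ⊗ (X m ⊗ W)` to `X (n + m) ⊗ W`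
  (`IsCoisometricProduct.exists_coisometry`). The same coisometry, with `E` in place of `W`, shows
  that the `T_n` are contractions (`SubproductSystem.norm_sum_shift_sq_le`).
* `T_n T_n* → 0` strongly, as `T_n` maps into degrees `≥ n` (`SubproductSystem.tendsto_rowOp_adjoint`).
* `T_0 T_0* = 1`, as `M` acts nondegenerately (`IsCovariantRep.rangeOp_zero`).

The W*-setting needs two more arguments. Elementary tensors are only σ-total in the tensor product of
two correspondences, and `IsSigmaTotal.eq_zero_of_inner_eq_zero` shows that this still gives norm
totality after tensoring with a normal representation. The representation of `M` on `W` is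
normal, which rests on a description of normality by strong convergence of nets (Vigier's
theorem, `tendsto_apply_of_isLUB`).
-/

noncomputable section

set_option linter.unusedSectionVars false

/-! ### Operators on and from the Hilbert space `X ⊗_ψ E` -/

section HilbertTensorOperators

variable {M : Type u} [NonUnitalCStarAlgebra M] [PartialOrder M] [StarOrderedRing M]
  {X : Type v} [NormedAddCommGroup X] [NormedSpace ℂ X] [SMul Mᵐᵒᵖ X] [CStarModule Mᵐᵒᵖ X]
  {Y : Type v} [NormedAddCommGroup Y] [NormedSpace ℂ Y] [SMul Mᵐᵒᵖ Y] [CStarModule Mᵐᵒᵖ Y]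
  {E : Type w} [NormedAddCommGroup E] [InnerProductSpace ℂ E] [CompleteSpace E]
  {F : Type*} [NormedAddCommGroup F] [InnerProductSpace ℂ F] [CompleteSpace F]
  {G : Type*} [NormedAddCommGroup G] [InnerProductSpace ℂ G] [CompleteSpace G]

namespace HilbertTensor

variable (X) in
/-- The canonical map from the algebraic tensor product `X ⊗ E` to `X ⊗_ψ E`. -/
def ofTensor (ψ : M →⋆ₙₐ[ℂ] (E →L[ℂ] E)) : X ⊗[ℂ] E →ₗ[ℂ] HilbertTensor X ψ :=
  (UniformSpace.Completion.toComplL (𝕜 := ℂ) (E := PreTensor X ψ)).toLinearMap ∘ₗ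
    (toPreTensor X ψ).toLinearMap

lemma ofTensor_tmul (ψ : M →⋆ₙₐ[ℂ] (E →L[ℂ] E)) (x : X) (h : E) :
    ofTensor X ψ (x ⊗ₜ h) = htmul ψ x h := rfl

lemma denseRange_ofTensor (ψ : M →⋆ₙₐ[ℂ] (E →L[ℂ] E)) : DenseRange (ofTensor X ψ) :=
  UniformSpace.Completion.denseRange_coe (α := PreTensor X ψ)

lemma htmul_add_left (ψ : M →⋆ₙₐ[ℂ] (E →L[ℂ] E)) (x x' : X) (h : E) :
    htmul ψ (x + x') h = htmul ψ x h + htmul ψ x' h := by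
  simp only [← ofTensor_tmul, TensorProduct.add_tmul, map_add]

lemma htmul_smul_left (ψ : M →⋆ₙₐ[ℂ] (E →L[ℂ] E)) (c : ℂ) (x : X) (h : E) :
    htmul ψ (c • x) h = c • htmul ψ x h := by
  simp only [← ofTensor_tmul, ← TensorProduct.smul_tmul', map_smul]

lemma htmul_add_right (ψ : M →⋆ₙₐ[ℂ] (E →L[ℂ] E)) (x : X) (h h' : E) :
    htmul ψ x (h + h') = htmul ψ x h + htmul ψ x h' := by
  simp only [← ofTensor_tmul, TensorProduct.tmul_add, map_add]

lemma htmul_smul_right (ψ : M →⋆ₙₐ[ℂ] (E →L[ℂ] E)) (c : ℂ) (x : X) (h : E) :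
    htmul ψ x (c • h) = c • htmul ψ x h := by
  simp only [← ofTensor_tmul, TensorProduct.tmul_smul, map_smul]

lemma norm_htmul_le (ψ : M →⋆ₙₐ[ℂ] (E →L[ℂ] E)) (x : X) (h : E) :
    ‖htmul ψ x h‖ ≤ ‖x‖ * ‖h‖ := by
  rw [← sq_le_sq₀ (norm_nonneg _) (by positivity), ← inner_self_eq_norm_sq (𝕜 := ℂ), inner_htmul]
  refine (Complex.re_le_norm _).trans ((norm_inner_le_norm _ _).trans ?_)
  have h1 : ‖ψ (mip M x x)‖ ≤ ‖x‖ ^ 2 := by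
    rw [← norm_mip_self (M := M)]
    exact NonUnitalStarAlgHom.norm_apply_le ψ _
  have h2 := (ψ (mip M x x)).le_of_opNorm_le h1 h
  calc _ ≤ ‖h‖ * (‖x‖ ^ 2 * ‖h‖) := by gcongr
    _ = _ := by ring

/-- The bounded operator `x ↦ x ⊗ h` from `X` to `X ⊗_ψ E`. -/
def htmulL (ψ : M →⋆ₙₐ[ℂ] (E →L[ℂ] E)) (h : E) : X →L[ℂ] HilbertTensor X ψ :=
  LinearMap.mkContinuous
    { toFun := fun x => htmul ψ x h
      map_add' := fun x x' => htmul_add_left ψ x x' h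
      map_smul' := fun c x => htmul_smul_left ψ c x h } ‖h‖
    fun x => (norm_htmul_le ψ x h).trans_eq (mul_comm _ _)

@[simp] lemma htmulL_apply (ψ : M →⋆ₙₐ[ℂ] (E →L[ℂ] E)) (h : E) (x : X) :
    htmulL ψ h x = htmul ψ x h := rfl

/-- The bounded operator `h ↦ x ⊗ h` from `E` to `X ⊗_ψ E`. -/
def htmulR (ψ : M →⋆ₙₐ[ℂ] (E →L[ℂ] E)) (x : X) : E →L[ℂ] HilbertTensor X ψ :=
  LinearMap.mkContinuous
    { toFun := fun h => htmul ψ x h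
      map_add' := htmul_add_right ψ x
      map_smul' := fun c h => htmul_smul_right ψ c x h } ‖x‖
    fun h => norm_htmul_le ψ x h

@[simp] lemma htmulR_apply (ψ : M →⋆ₙₐ[ℂ] (E →L[ℂ] E)) (x : X) (h : E) :
    htmulR ψ x h = htmul ψ x h := rfl

/-- Induction on `X ⊗_ψ E`, for closed properties: the elementary tensors are total. -/
lemma induction_on (ψ : M →⋆ₙₐ[ℂ] (E →L[ℂ] E)) {p : HilbertTensor X ψ → Prop}
    (hc : IsClosed {z | p z}) (h0 : p 0) (hadd : ∀ z z', p z → p z' → p (z + z'))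
    (ht : ∀ x h, p (htmul ψ x h)) (z : HilbertTensor X ψ) : p z := by
  refine (denseRange_ofTensor ψ).induction_on z hc fun z => ?_
  induction z with
  | zero => simpa using h0
  | tmul x h => exact ht x h
  | add a b ha hb => rw [map_add]; exact hadd _ _ ha hb

lemma ext_inner_htmul {ψ : M →⋆ₙₐ[ℂ] (E →L[ℂ] E)} {z z' : HilbertTensor X ψ}
    (h : ∀ x e, inner ℂ z (htmul ψ x e) = inner ℂ z' (htmul ψ x e)) : z = z' := by
  refine ext_inner_right ℂ fun y => ?_
  induction y using induction_on with
  | hc => exact isClosed_eq (by fun_prop) (by fun_prop)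
  | h0 => simp
  | hadd a b ha hb => rw [inner_add_right, inner_add_right, ha, hb]
  | ht x e => exact h x e

lemma clm_ext {ψ : M →⋆ₙₐ[ℂ] (E →L[ℂ] E)} {f g : HilbertTensor X ψ →L[ℂ] F}
    (h : ∀ x e, f (htmul ψ x e) = g (htmul ψ x e)) : f = g := by
  ext z
  induction z using induction_on with
  | hc => exact isClosed_eq (by fun_prop) (by fun_prop)
  | h0 => simp
  | hadd a b ha hb => rw [map_add, map_add, ha, hb]
  | ht x e => exact h x e

/-- The operator `x ⊗ h ↦ f x h` for a bilinear map `f : X × E → F` that is bounded for the norm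
of `X ⊗_ψ E`; it has the junk value of `LinearMap.extendOfNorm` for other `f`. -/
def lift (ψ : M →⋆ₙₐ[ℂ] (E →L[ℂ] E)) (f : X →ₗ[ℂ] E →ₗ[ℂ] F) : HilbertTensor X ψ →L[ℂ] F :=
  (TensorProduct.lift f).extendOfNorm (ofTensor X ψ)

/-- The bilinear map `f : X × E → F` satisfies
`‖∑ f (xᵢ) (hᵢ)‖² ≤ C² ∑ ⟨hᵢ, ψ(⟨xᵢ, xⱼ⟩) hⱼ⟩`, and so defines an operator on `X ⊗_ψ E` of norm at
most `C`. -/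
def IsTensorBounded (ψ : M →⋆ₙₐ[ℂ] (E →L[ℂ] E)) (f : X →ₗ[ℂ] E →ₗ[ℂ] F) (C : ℝ) : Prop :=
  ∀ (n : ℕ) (x : Fin n → X) (h : Fin n → E), ‖∑ i, f (x i) (h i)‖ ^ 2 ≤
    C ^ 2 * (∑ i, ∑ j, inner ℂ (h i) (ψ (mip M (x i) (x j)) (h j)) : ℂ).re

lemma norm_sum_htmul_sq (ψ : M →⋆ₙₐ[ℂ] (E →L[ℂ] E)) {n : ℕ} (x : Fin n → X) (h : Fin n → E) :
    ‖∑ i, htmul ψ (x i) (h i)‖ ^ 2 =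
      (∑ i, ∑ j, inner ℂ (h i) (ψ (mip M (x i) (x j)) (h j)) : ℂ).re := by
  rw [← inner_self_eq_norm_sq (𝕜 := ℂ)]
  simp only [sum_inner, inner_sum, inner_htmul]
  rw [Finset.sum_comm]
  rfl

lemma IsTensorBounded.le {ψ : M →⋆ₙₐ[ℂ] (E →L[ℂ] E)} {f : X →ₗ[ℂ] E →ₗ[ℂ] F} {C : ℝ}
    (hf : IsTensorBounded ψ f C) (hC : 0 ≤ C) (z : X ⊗[ℂ] E) :
    ‖TensorProduct.lift f z‖ ≤ C * ‖ofTensor X ψ z‖ := by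
  obtain ⟨n, x, h, rfl⟩ := exists_sum_tmul z
  rw [← sq_le_sq₀ (norm_nonneg _) (by positivity), mul_pow]
  simp only [map_sum, TensorProduct.lift.tmul, ofTensor_tmul]
  rw [norm_sum_htmul_sq]
  exact hf n x h

lemma lift_htmul {ψ : M →⋆ₙₐ[ℂ] (E →L[ℂ] E)} {f : X →ₗ[ℂ] E →ₗ[ℂ] F} {C : ℝ}
    (hf : IsTensorBounded ψ f C) (hC : 0 ≤ C) (x : X) (h : E) :
    lift ψ f (htmul ψ x h) = f x h :=
  LinearMap.extendOfNorm_eq (denseRange_ofTensor ψ) ⟨C, hf.le hC⟩ (x ⊗ₜ h)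

lemma norm_lift_le {ψ : M →⋆ₙₐ[ℂ] (E →L[ℂ] E)} {f : X →ₗ[ℂ] E →ₗ[ℂ] F} {C : ℝ}
    (hf : IsTensorBounded ψ f C) (hC : 0 ≤ C) (z : HilbertTensor X ψ) :
    ‖lift ψ f z‖ ≤ C * ‖z‖ :=
  LinearMap.norm_extendOfNorm_apply_le (denseRange_ofTensor ψ) C (hf.le hC) z

lemma isTensorBounded_of_inner_eq {ψ : M →⋆ₙₐ[ℂ] (E →L[ℂ] E)} {f : X →ₗ[ℂ] E →ₗ[ℂ] F}
    (hf : ∀ x h x' h', inner ℂ (f x h) (f x' h') = inner ℂ h (ψ (mip M x x') h')) :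
    IsTensorBounded ψ f 1 := fun n x h => by
  rw [← inner_self_eq_norm_sq (𝕜 := ℂ)]
  simp only [sum_inner, inner_sum, hf]
  rw [Finset.sum_comm, one_pow, one_mul]
  rfl

lemma inner_lift_lift {ψ : M →⋆ₙₐ[ℂ] (E →L[ℂ] E)} {f : X →ₗ[ℂ] E →ₗ[ℂ] F}
    (hf : ∀ x h x' h', inner ℂ (f x h) (f x' h') = inner ℂ h (ψ (mip M x x') h'))
    (z z' : HilbertTensor X ψ) : inner ℂ (lift ψ f z) (lift ψ f z') = inner ℂ z z' := by
  have hb := isTensorBounded_of_inner_eq hf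
  induction z using induction_on with
  | hc => exact isClosed_eq (by fun_prop) (by fun_prop)
  | h0 => simp
  | hadd a b ha hb => rw [map_add, inner_add_left, inner_add_left, ha, hb]
  | ht x h =>
    induction z' using induction_on with
    | hc => exact isClosed_eq (by fun_prop) (by fun_prop)
    | h0 => simp
    | hadd a b ha hb => rw [map_add, inner_add_right, inner_add_right, ha, hb]
    | ht x' h' => rw [lift_htmul hb zero_le_one, lift_htmul hb zero_le_one, hf, inner_htmul]

lemma re_sum_inner_gram (θ : M →⋆ₙₐ[ℂ] (E →L[ℂ] E)) {ι : Type*} [Fintype ι] (G R : ι → ι → M)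
    (hR : ∀ i j, G i j = ∑ l, star (R l i) * R l j) (g : ι → E) :
    (∑ i, ∑ j, inner ℂ (g i) (θ (G i j) (g j)) : ℂ).re = ∑ l, ‖∑ i, θ (R l i) (g i)‖ ^ 2 := by
  simp_rw [← inner_self_eq_norm_sq (𝕜 := ℂ)]
  rw [← map_sum]
  change _ = Complex.re _
  refine congrArg Complex.re ?_
  have h1 : ∀ i j, inner ℂ (g i) (θ (G i j) (g j)) =
      ∑ l, inner ℂ (θ (R l i) (g i)) (θ (R l j) (g j)) := fun i j => by
    rw [hR, map_sum, sum_apply, inner_sum]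
    refine Finset.sum_congr rfl fun l _ => ?_
    rw [map_mul, map_star, ContinuousLinearMap.star_eq_adjoint,
      ← ContinuousLinearMap.adjoint_inner_right]
    rfl
  simp only [h1, sum_inner, inner_sum]
  calc _ = ∑ i, ∑ l, ∑ j, inner ℂ (θ (R l i) (g i)) (θ (R l j) (g j)) :=
        Finset.sum_congr rfl fun i _ => Finset.sum_comm
    _ = ∑ l, ∑ i, ∑ j, inner ℂ (θ (R l i) (g i)) (θ (R l j) (g j)) := Finset.sum_comm
    _ = _ := Finset.sum_congr rfl fun l _ => Finset.sum_comm

/-- If `B : E → F` intertwines the representations `ψ` and `φ`, then `1 ⊗ B` is bounded: the Gram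
matrix `⟨xᵢ, xⱼ⟩` is of the form `R* R`, and `‖∑ φ(Rₗᵢ) B hᵢ‖ = ‖B ∑ ψ(Rₗᵢ) hᵢ‖`. -/
lemma isTensorBounded_mapRight {ψ : M →⋆ₙₐ[ℂ] (E →L[ℂ] E)} {φ : M →⋆ₙₐ[ℂ] (F →L[ℂ] F)}
    (B : E →L[ℂ] F) (hB : ∀ a h, B (ψ a h) = φ a (B h)) :
    IsTensorBounded ψ (LinearMap.mk₂ ℂ (fun (x : X) (h : E) => htmul φ x (B h))
      (fun x x' h => htmul_add_left φ x x' _) (fun c x h => htmul_smul_left φ c x _)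
      (fun x h h' => by rw [map_add, htmul_add_right])
      (fun c x h => by rw [map_smul, htmul_smul_right])) ‖B‖ := fun n x h => by
  simp only [LinearMap.mk₂_apply]
  rw [norm_sum_htmul_sq]
  obtain ⟨R, hR⟩ := exists_sq_of_form_nonneg (fun i j => mip M (x i) (x j))
    (fun i j => star_mip _ _) (fun a => by
      have h1 := mip_self_nonneg (M := M) (∑ i, op (a i) • x i)
      simp only [mip_sum_left, mip_sum_right, mip_op_left, mip_op_right, Finset.sum_mul] at h1
      rwa [Finset.sum_comm] at h1)
  rw [re_sum_inner_gram φ _ R hR, re_sum_inner_gram ψ _ R hR, Finset.mul_sum]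
  refine Finset.sum_le_sum fun l _ => ?_
  simp only [← hB, ← map_sum]
  rw [← mul_pow]
  gcongr
  exact B.le_opNorm _

variable (X) in
/-- The operator `1 ⊗ B : X ⊗_ψ E → X ⊗_φ F` of an operator `B : E → F` that intertwines `ψ`
and `φ`; it has a junk value for other `B`. -/
def mapRight {ψ : M →⋆ₙₐ[ℂ] (E →L[ℂ] E)} {φ : M →⋆ₙₐ[ℂ] (F →L[ℂ] F)}
    (B : E →L[ℂ] F) : HilbertTensor X ψ →L[ℂ] HilbertTensor X φ :=
  lift ψ (LinearMap.mk₂ ℂ (fun (x : X) (h : E) => htmul φ x (B h))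
      (fun x x' h => htmul_add_left φ x x' _) (fun c x h => htmul_smul_left φ c x _)
      (fun x h h' => by rw [map_add, htmul_add_right])
      (fun c x h => by rw [map_smul, htmul_smul_right]))

lemma mapRight_htmul {ψ : M →⋆ₙₐ[ℂ] (E →L[ℂ] E)} {φ : M →⋆ₙₐ[ℂ] (F →L[ℂ] F)}
    {B : E →L[ℂ] F} (hB : ∀ a h, B (ψ a h) = φ a (B h)) (x : X) (h : E) :
    mapRight X (ψ := ψ) (φ := φ) B (htmul ψ x h) = htmul φ x (B h) :=
  lift_htmul (isTensorBounded_mapRight B hB) (norm_nonneg B) x h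

lemma intertwines_adjoint {ψ : M →⋆ₙₐ[ℂ] (E →L[ℂ] E)} {φ : M →⋆ₙₐ[ℂ] (F →L[ℂ] F)}
    {B : E →L[ℂ] F} (hB : ∀ a h, B (ψ a h) = φ a (B h)) (a : M) (h : F) :
    B.adjoint (φ a h) = ψ a (B.adjoint h) := by
  refine ext_inner_left ℂ fun y => ?_
  rw [ContinuousLinearMap.adjoint_inner_right, ← ContinuousLinearMap.adjoint_inner_left,
    ← ContinuousLinearMap.adjoint_inner_left (ψ a), ContinuousLinearMap.adjoint_inner_right,
    ← ContinuousLinearMap.star_eq_adjoint, ← ContinuousLinearMap.star_eq_adjoint, ← map_star,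
    ← map_star, hB]

lemma adjoint_mapRight {ψ : M →⋆ₙₐ[ℂ] (E →L[ℂ] E)} {φ : M →⋆ₙₐ[ℂ] (F →L[ℂ] F)}
    {B : E →L[ℂ] F} (hB : ∀ a h, B (ψ a h) = φ a (B h)) :
    (mapRight X (ψ := ψ) (φ := φ) B).adjoint = mapRight X (ψ := φ) (φ := ψ) B.adjoint := by
  refine clm_ext fun x e => ext_inner_htmul fun x' e' => ?_
  rw [ContinuousLinearMap.adjoint_inner_left, mapRight_htmul hB,
    mapRight_htmul (intertwines_adjoint hB), inner_htmul, inner_htmul, ← hB,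
    ContinuousLinearMap.adjoint_inner_left]

lemma mapRight_comp {ψ : M →⋆ₙₐ[ℂ] (E →L[ℂ] E)} {φ : M →⋆ₙₐ[ℂ] (F →L[ℂ] F)}
    {θ : M →⋆ₙₐ[ℂ] (G →L[ℂ] G)} {B : E →L[ℂ] F} (hB : ∀ a h, B (ψ a h) = φ a (B h))
    {C : F →L[ℂ] G} (hC : ∀ a h, C (φ a h) = θ a (C h)) :
    mapRight X (ψ := φ) (φ := θ) C ∘L mapRight X (ψ := ψ) (φ := φ) B =
      mapRight X (ψ := ψ) (φ := θ) (C ∘L B) := by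
  refine clm_ext fun x e => ?_
  have hCB : ∀ a h, (C ∘L B) (ψ a h) = θ a ((C ∘L B) h) := fun a h => by simp [hB, hC]
  rw [ContinuousLinearMap.comp_apply, mapRight_htmul hB, mapRight_htmul hC, mapRight_htmul hCB]
  rfl

end HilbertTensor

end HilbertTensorOperators

/-- For an isometry `L` with dense range, `L L* = 1`. -/
lemma comp_adjoint_eq_id_of_denseRange {H K : Type*} [NormedAddCommGroup H] [InnerProductSpace ℂ H]
    [CompleteSpace H] [NormedAddCommGroup K] [InnerProductSpace ℂ K] [CompleteSpace K]
    (L : H →L[ℂ] K) (hL : ∀ x y, inner ℂ (L x) (L y) = inner ℂ x y) (hd : DenseRange L) :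
    L ∘L L.adjoint = .id ℂ K := by
  have h1 : L.adjoint ∘L L = .id ℂ H := by
    ext x
    refine ext_inner_right ℂ fun y => ?_
    rw [ContinuousLinearMap.comp_apply, ContinuousLinearMap.adjoint_inner_left, hL]
    rfl
  ext y
  refine hd.induction_on y (isClosed_eq (by fun_prop) (by fun_prop)) fun x => ?_
  change L ((L.adjoint ∘L L) x) = L x
  rw [h1]
  rfl

/-! ### The left action on `X ⊗_ψ E`, and associativity of the tensor product -/

namespace AStarCorrespondence

variable {k : AStarKind} {M : Type u} [NonUnitalCStarAlgebra M] [PartialOrder M]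
  (X : AStarCorrespondence.{u, v} k M)

lemma left_op (a b : M) (x : X) : X.left a (op b • x) = op b • X.left a x := by
  have h : ∀ z, mip M (X.left a z) x = mip M z (X.left (star a) x) := fun z => X.mip_left a z x
  refine mip_ext (M := M) fun z => ?_
  have h1 := X.mip_left (star a) z (op b • x)
  have h2 := X.mip_left (star a) z x
  rw [star_star] at h1 h2
  rw [mip_op_right, ← h1, ← h2, mip_op_right]

variable [StarOrderedRing M]

lemma mip_left_left_le (a : M) (x : X) :
    mip M (X.left a x) (X.left a x) ≤ ((‖a‖ ^ 2 : ℝ) : ℂ) • mip M x x := by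
  have h1 := X.mip_left_le (star a * a) (IsSelfAdjoint.star_mul_self a) x
  rw [CStarRing.norm_star_mul_self, ← pow_two, map_mul] at h1
  rw [X.mip_left]
  exact h1

variable {E : Type w} [NormedAddCommGroup E] [InnerProductSpace ℂ E] [CompleteSpace E]

/-- The operator `a ⊗ 1` on `X ⊗_ψ E`. -/
def leftTensor (ψ : M →⋆ₙₐ[ℂ] (E →L[ℂ] E)) (a : M) :
    HilbertTensor X ψ →L[ℂ] HilbertTensor X ψ :=
  hilbertTensorMap ψ (X.left a).toLinearMap ‖a‖ (norm_nonneg a) (X.left_op a)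
    (X.mip_left_left_le a)

@[simp] lemma leftTensor_htmul (ψ : M →⋆ₙₐ[ℂ] (E →L[ℂ] E)) (a : M) (x : X) (h : E) :
    X.leftTensor ψ a (htmul ψ x h) = htmul ψ (X.left a x) h :=
  hilbertTensorMap_htmul _ _ _ _ _ _ _ _

/-- The representation `a ↦ a ⊗ 1` of `M` on `X ⊗_ψ E`. -/
def leftRep (ψ : M →⋆ₙₐ[ℂ] (E →L[ℂ] E)) :
    M →⋆ₙₐ[ℂ] (HilbertTensor X ψ →L[ℂ] HilbertTensor X ψ) where
  toFun := X.leftTensor ψ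
  map_smul' c a := HilbertTensor.clm_ext fun x h => by
    simp [HilbertTensor.htmul_smul_left]
  map_zero' := HilbertTensor.clm_ext fun x h => by
    rw [leftTensor_htmul, map_zero]
    exact map_zero (HilbertTensor.htmulL ψ h)
  map_add' a b := HilbertTensor.clm_ext fun x h => by
    simp [HilbertTensor.htmul_add_left]
  map_mul' a b := HilbertTensor.clm_ext fun x h => by
    simp
  map_star' a := HilbertTensor.clm_ext fun x h => HilbertTensor.ext_inner_htmul fun x' h' => by
    rw [ContinuousLinearMap.star_eq_adjoint, ContinuousLinearMap.adjoint_inner_left,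
      leftTensor_htmul, leftTensor_htmul, inner_htmul, inner_htmul, X.mip_left, star_star]

@[simp] lemma leftRep_htmul (ψ : M →⋆ₙₐ[ℂ] (E →L[ℂ] E)) (a : M) (x : X) (h : E) :
    X.leftRep ψ a (htmul ψ x h) = htmul ψ (X.left a x) h :=
  X.leftTensor_htmul ψ a x h

end AStarCorrespondence

namespace IsInteriorTensorProduct

variable {k : AStarKind} {M : Type u} [NonUnitalCStarAlgebra M] [PartialOrder M]
  [StarOrderedRing M]
  {X Y Z : AStarCorrespondence.{u, v} k M} {t : X →ₗ[ℂ] Y →ₗ[ℂ] Z}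
  {E : Type w} [NormedAddCommGroup E] [InnerProductSpace ℂ E] [CompleteSpace E]

/-- The operator `y ⊗ h ↦ t x y ⊗ h` from `Y ⊗_ψ E` to `(X ⊗ Y) ⊗_ψ E`. -/
def leftMul (ht : IsInteriorTensorProduct t) (ψ : M →⋆ₙₐ[ℂ] (E →L[ℂ] E)) (x : X) :
    HilbertTensor Y ψ →L[ℂ] HilbertTensor Z ψ :=
  hilbertTensorMap ψ (t x) ‖x‖ (norm_nonneg x) (fun a y => ht.tmul_op x y a) (ht.tmul_le x)

@[simp] lemma leftMul_htmul (ht : IsInteriorTensorProduct t) (ψ : M →⋆ₙₐ[ℂ] (E →L[ℂ] E))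
    (x : X) (y : Y) (h : E) : ht.leftMul ψ x (htmul ψ y h) = htmul ψ (t x y) h :=
  hilbertTensorMap_htmul _ _ _ _ _ _ _ _

lemma inner_leftMul (ht : IsInteriorTensorProduct t) (ψ : M →⋆ₙₐ[ℂ] (E →L[ℂ] E)) (x x' : X)
    (ξ ξ' : HilbertTensor Y ψ) : inner ℂ (ht.leftMul ψ x ξ) (ht.leftMul ψ x' ξ') =
      inner ℂ ξ (Y.leftRep ψ (mip M x x') ξ') := by
  induction ξ using HilbertTensor.induction_on with
  | hc => exact isClosed_eq (by fun_prop) (by fun_prop)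
  | h0 => simp
  | hadd a b ha hb => rw [map_add, inner_add_left, inner_add_left, ha, hb]
  | ht y h =>
    induction ξ' using HilbertTensor.induction_on with
    | hc => exact isClosed_eq (by fun_prop) (by fun_prop)
    | h0 => simp
    | hadd a b ha hb => rw [map_add, map_add, inner_add_right, inner_add_right, ha, hb]
    | ht y' h' =>
      rw [leftMul_htmul, leftMul_htmul, AStarCorrespondence.leftRep_htmul, inner_htmul,
        inner_htmul, ht.mip_tmul]

/-- The bilinear map `(x, y ⊗ h) ↦ t x y ⊗ h`. -/
def leftMulₗ (ht : IsInteriorTensorProduct t) (ψ : M →⋆ₙₐ[ℂ] (E →L[ℂ] E)) :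
    X →ₗ[ℂ] HilbertTensor Y ψ →ₗ[ℂ] HilbertTensor Z ψ where
  toFun x := (ht.leftMul ψ x).toLinearMap
  map_add' x x' := by
    have : ht.leftMul ψ (x + x') = ht.leftMul ψ x + ht.leftMul ψ x' :=
      HilbertTensor.clm_ext fun y h => by simp [HilbertTensor.htmul_add_left]
    rw [this]; rfl
  map_smul' c x := by
    have : ht.leftMul ψ (c • x) = c • ht.leftMul ψ x :=
      HilbertTensor.clm_ext fun y h => by simp [HilbertTensor.htmul_smul_left]
    rw [this]; rfl

/-- The isometry `x ⊗ (y ⊗ h) ↦ t x y ⊗ h` from `X ⊗ (Y ⊗_ψ E)` to `(X ⊗ Y) ⊗_ψ E`. -/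
def assoc (ht : IsInteriorTensorProduct t) (ψ : M →⋆ₙₐ[ℂ] (E →L[ℂ] E)) :
    HilbertTensor X (Y.leftRep ψ) →L[ℂ] HilbertTensor Z ψ :=
  HilbertTensor.lift (Y.leftRep ψ) (ht.leftMulₗ ψ)

lemma inner_assoc (ht : IsInteriorTensorProduct t) (ψ : M →⋆ₙₐ[ℂ] (E →L[ℂ] E))
    (z z' : HilbertTensor X (Y.leftRep ψ)) :
    inner ℂ (ht.assoc ψ z) (ht.assoc ψ z') = inner ℂ z z' :=
  HilbertTensor.inner_lift_lift (fun x ξ x' ξ' => ht.inner_leftMul ψ x x' ξ ξ') z z'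

lemma assoc_htmul (ht : IsInteriorTensorProduct t) (ψ : M →⋆ₙₐ[ℂ] (E →L[ℂ] E))
    (x : X) (ξ : HilbertTensor Y ψ) :
    ht.assoc ψ (htmul (Y.leftRep ψ) x ξ) = ht.leftMul ψ x ξ :=
  HilbertTensor.lift_htmul (HilbertTensor.isTensorBounded_of_inner_eq
    (fun x ξ x' ξ' => ht.inner_leftMul ψ x x' ξ ξ')) zero_le_one x ξ

lemma denseRange_assoc (ht : IsInteriorTensorProduct t) (ψ : M →⋆ₙₐ[ℂ] (E →L[ℂ] E))
    (htot : ∀ ξ : HilbertTensor Z ψ,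
      (∀ x y h, inner ℂ ξ (htmul ψ (t x y) h) = 0) → ξ = 0) : DenseRange (ht.assoc ψ) := by
  have h1 : (LinearMap.range (ht.assoc ψ).toLinearMap).topologicalClosure = ⊤ := by
    rw [Submodule.topologicalClosure_eq_top_iff, Submodule.eq_bot_iff]
    intro ξ hξ
    refine htot ξ fun x y h => ?_
    rw [← ht.leftMul_htmul, ← ht.assoc_htmul, inner_eq_zero_symm]
    exact hξ _ ⟨_, rfl⟩
  have h2 := Submodule.dense_iff_topologicalClosure_eq_top.2 h1
  exact h2

/-- In the C*-setting the tensors `(x ⊗ y) ⊗ h` are total in `(X ⊗ Y) ⊗_ψ E`. -/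
lemma eq_zero_of_inner_eq_zero_of_cstar (ht : IsInteriorTensorProduct t) (hk : k = .cstar)
    (ψ : M →⋆ₙₐ[ℂ] (E →L[ℂ] E)) (ξ : HilbertTensor Z ψ)
    (h0 : ∀ x y h, inner ℂ ξ (htmul ψ (t x y) h) = 0) : ξ = 0 := by
  refine HilbertTensor.ext_inner_htmul fun z h => ?_
  rw [inner_zero_left]
  let f : Z →L[ℂ] ℂ := innerSL ℂ ξ ∘L HilbertTensor.htmulL ψ h
  have h1 : (Submodule.span ℂ {z : Z | ∃ x y, z = t x y}).topologicalClosure ≤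
      LinearMap.ker f.toLinearMap := by
    refine Submodule.topologicalClosure_minimal _ (Submodule.span_le.2 ?_) f.isClosed_ker
    rintro _ ⟨x, y, rfl⟩
    exact h0 x y h
  rw [ht.total_norm hk] at h1
  exact h1 Submodule.mem_top

end IsInteriorTensorProduct

namespace IsCoisometricBimoduleMap

variable {k : AStarKind} {M : Type u} [NonUnitalCStarAlgebra M] [PartialOrder M]
  [StarOrderedRing M]
  {K Z : AStarCorrespondence.{u, v} k M} {U : K →L[ℂ] Z}
  {E : Type w} [NormedAddCommGroup E] [InnerProductSpace ℂ E] [CompleteSpace E]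

/-- A coisometric bimodule map `U` induces a coisometry `U ⊗ 1` with adjoint `U* ⊗ 1`. -/
lemma exists_tensor (hU : IsCoisometricBimoduleMap U) (ψ : M →⋆ₙₐ[ℂ] (E →L[ℂ] E)) :
    ∃ W : HilbertTensor K ψ →L[ℂ] HilbertTensor Z ψ,
      (∀ x h, W (htmul ψ x h) = htmul ψ (U x) h) ∧ W ∘L W.adjoint = .id ℂ _ := by
  obtain ⟨-, V, hV, hUV⟩ := hU
  have hV' : ∀ z x, mip M z (U x) = mip M (V z) x := fun z x => by
    rw [← star_mip, hV, star_mip]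
  have hU1 : ∀ (a : M) (x : K), U (op a • x) = op a • U x := fun a x =>
    mip_ext (M := M) fun z => by rw [mip_op_right, hV', hV', mip_op_right]
  have hV1 : ∀ (a : M) (x : Z), V (op a • x) = op a • V x := fun a x =>
    mip_ext (M := M) fun z => by rw [mip_op_right, ← hV, ← hV, mip_op_right]
  have hU2 : ∀ x, mip M (U x) (U x) ≤ (((1 : ℝ) ^ 2 : ℝ) : ℂ) • mip M x x := fun x => by
    have h1 := mip_self_nonneg (M := M) (x - V (U x))
    rw [mip_sub_left, mip_sub_right, mip_sub_right, ← hV, ← hV, ← hV', hUV, sub_self,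
      sub_zero] at h1
    simpa using h1
  have hV2 : ∀ x, mip M (V x) (V x) ≤ (((1 : ℝ) ^ 2 : ℝ) : ℂ) • mip M x x := fun x => by
    rw [← hV, hUV]; simp
  let W := hilbertTensorMap ψ U.toLinearMap 1 zero_le_one hU1 hU2
  let W' := hilbertTensorMap ψ V.toLinearMap 1 zero_le_one hV1 hV2
  have hW : ∀ x h, W (htmul ψ x h) = htmul ψ (U x) h := hilbertTensorMap_htmul _ _ _ _ _ _
  have hW' : ∀ x h, W' (htmul ψ x h) = htmul ψ (V x) h := hilbertTensorMap_htmul _ _ _ _ _ _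
  have hadj : W.adjoint = W' := HilbertTensor.clm_ext fun x h =>
    HilbertTensor.ext_inner_htmul fun x' h' => by
      rw [ContinuousLinearMap.adjoint_inner_left, hW, hW', inner_htmul, inner_htmul, hV']
  refine ⟨W, hW, HilbertTensor.clm_ext fun x h => ?_⟩
  rw [hadj, ContinuousLinearMap.comp_apply, hW', hW, hUV]
  rfl

end IsCoisometricBimoduleMap

/-! ### Normal representations -/

section Normality

open Filter Topology

variable {H : Type*} [NormedAddCommGroup H] [InnerProductSpace ℂ H] [CompleteSpace H]

lemma nonneg_iff_inner_nonneg {T : H →L[ℂ] H} : 0 ≤ T ↔ ∀ v, 0 ≤ (inner ℂ (T v) v : ℂ) := by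
  rw [ContinuousLinearMap.nonneg_iff_isPositive]
  refine ⟨fun h v => h.inner_nonneg_left v, fun h => ?_⟩
  rw [ContinuousLinearMap.isPositive_iff_complex]
  intro v
  obtain ⟨h1, h2⟩ := Complex.nonneg_iff.1 (h v)
  exact ⟨Complex.ext rfl (by simpa using h2), h1⟩

lemma norm_apply_sq_le_of_nonneg {T : H →L[ℂ] H} (hT : 0 ≤ T) (v : H) :
    ‖T v‖ ^ 2 ≤ ‖T‖ * (inner ℂ (T v) v : ℂ).re := by
  obtain ⟨q, rfl⟩ := CStarAlgebra.nonneg_iff_eq_star_mul_self.1 hT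
  have h1 : (inner ℂ ((star q * q) v) v : ℂ).re = ‖q v‖ ^ 2 := by
    rw [← inner_self_eq_norm_sq (𝕜 := ℂ), ContinuousLinearMap.star_eq_adjoint]
    exact congrArg Complex.re (ContinuousLinearMap.adjoint_inner_left q v (q v))
  rw [h1, CStarRing.norm_star_mul_self, ← pow_two, ← mul_pow]
  refine pow_le_pow_left₀ (norm_nonneg _) ?_ 2
  have := (star q).le_opNorm (q v)
  rwa [norm_star] at this

/-- **Vigier's theorem**: an increasing net of operators converges strongly to its supremum. -/
lemma tendsto_apply_of_isLUB {ι : Type*} [Preorder ι] [IsDirectedOrder ι] [Nonempty ι]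
    {T : ι → H →L[ℂ] H} {T₀ : H →L[ℂ] H} (hT : Monotone T) (h : IsLUB (Set.range T) T₀) (v : H) :
    Tendsto (fun i => (T₀ - T i) v) atTop (𝓝 0) := by
  set P : ι → H →L[ℂ] H := fun i => T₀ - T i with hP
  have hPi : ∀ i, 0 ≤ P i := fun i => sub_nonneg.2 (h.1 ⟨i, rfl⟩)
  have hPanti : ∀ {i j}, i ≤ j → 0 ≤ P i - P j := fun {i j} hij => by
    simpa [hP] using hT hij
  let i₀ : ι := Classical.arbitrary ι
  have hre : ∀ {S : H →L[ℂ] H}, 0 ≤ S → ∀ v, 0 ≤ (inner ℂ (S v) v : ℂ).re := fun hS v =>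
    (Complex.nonneg_iff.1 (nonneg_iff_inner_nonneg.1 hS v)).1
  -- the quadratic forms decrease, so the vectors `P i v` form a Cauchy net
  have hlim : ∀ v, ∃ w, Tendsto (fun i => P i v) atTop (𝓝 w) := fun v => by
    refine cauchySeq_tendsto_of_complete (Metric.cauchy_iff.2 ⟨inferInstance, fun ε hε => ?_⟩)
    set c : ι → ℝ := fun i => (inner ℂ (P i v) v : ℂ).re with hc
    have hcanti : Antitone c := fun i j hij => by
      have := hre (hPanti hij) v
      rw [sub_apply, inner_sub_left, Complex.sub_re] at this
      exact sub_nonneg.1 this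
    have hbdd : BddBelow (Set.range c) := ⟨0, by rintro _ ⟨i, rfl⟩; exact hre (hPi i) v⟩
    obtain ⟨N₁, hN₁⟩ := exists_lt_of_ciInf_lt
      (lt_add_of_pos_right (⨅ i, c i) (show 0 < (ε / 2) ^ 2 / (‖P i₀‖ + 1) by positivity))
    obtain ⟨N, hN, hN₀⟩ := exists_ge_ge N₁ i₀
    have key : ∀ i, N ≤ i → ‖P N v - P i v‖ < ε / 2 := fun i hi => by
      rw [← sq_lt_sq₀ (norm_nonneg _) (by positivity)]
      have h1 := norm_apply_sq_le_of_nonneg (hPanti hi) v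
      have h2 : ‖P N - P i‖ ≤ ‖P i₀‖ := CStarAlgebra.norm_le_norm_of_nonneg_of_le (hPanti hi)
        ((sub_le_self _ (hPi i)).trans (sub_le_sub_left (hT hN₀) T₀))
      have h3 : (inner ℂ ((P N - P i) v) v : ℂ).re = c N - c i := by
        rw [sub_apply, inner_sub_left, Complex.sub_re]
      have h4 : c N - c i < (ε / 2) ^ 2 / (‖P i₀‖ + 1) := by
        have := ciInf_le hbdd i
        have := hcanti hN
        linarith
      rw [h3] at h1
      have h5 : 0 ≤ c N - c i := sub_nonneg.2 (hcanti hi)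
      rw [lt_div_iff₀ (by positivity)] at h4
      calc ‖P N v - P i v‖ ^ 2 ≤ ‖P N - P i‖ * (c N - c i) := h1
        _ ≤ (‖P i₀‖ + 1) * (c N - c i) := by gcongr; linarith
        _ < (ε / 2) ^ 2 := by linarith
    refine ⟨(fun i => P i v) '' Set.Ici N, image_mem_map (Ici_mem_atTop N), ?_⟩
    rintro _ ⟨i, hi, rfl⟩ _ ⟨j, hj, rfl⟩
    have h1 := key i hi
    have h2 := key j hj
    rw [← dist_eq_norm] at h1 h2
    linarith [dist_triangle_left (P i v) (P j v) (P N v)]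
  choose f hf using hlim
  have hbound : ∀ v, ‖f v‖ ≤ ‖P i₀‖ * ‖v‖ := fun v => by
    refine le_of_tendsto (hf v).norm ?_
    filter_upwards [eventually_ge_atTop i₀] with i hi
    exact (P i).le_of_opNorm_le (CStarAlgebra.norm_le_norm_of_nonneg_of_le (hPi i)
      (sub_le_sub_left (hT hi) T₀)) v
  let A : H →L[ℂ] H := (linearMapOfTendsto f (fun i => (P i).toLinearMap)
    (tendsto_pi_nhds.2 hf)).mkContinuous _ hbound
  have hA : ∀ v, Tendsto (fun i => P i v) atTop (𝓝 (A v)) := hf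
  have hA0 : 0 ≤ A := nonneg_iff_inner_nonneg.2 fun v =>
    ge_of_tendsto' ((hA v).inner tendsto_const_nhds) fun i =>
      nonneg_iff_inner_nonneg.1 (hPi i) v
  -- `T₀ - A` is an upper bound, so that `A ≤ 0`
  have hA1 : T₀ ≤ T₀ - A := h.2 (by
    rintro _ ⟨i, rfl⟩
    have h1 : 0 ≤ P i - A := nonneg_iff_inner_nonneg.2 fun v => by
      refine ge_of_tendsto ((tendsto_const_nhds.sub (hA v)).inner tendsto_const_nhds) ?_
      filter_upwards [eventually_ge_atTop i] with j hj
      exact nonneg_iff_inner_nonneg.1 (hPanti hj) v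
    rw [← sub_nonneg]
    convert h1 using 1
    simp only [hP]
    abel)
  have hA2 : A = 0 := le_antisymm (by simpa using hA1) hA0
  have := hA v
  rwa [hA2, zero_apply] at this

variable {M : Type u} [NonUnitalCStarAlgebra M] [PartialOrder M]

lemma IsNormalMap.monotone {A B : Type*} [Preorder A] [Preorder B] {f : A → B}
    (hf : IsNormalMap f) : Monotone f := fun a b hab => by
  refine (hf {a, b} b ⟨a, by simp⟩ ?_ ?_).1 ⟨a, by simp, rfl⟩
  · have hle : ∀ x ∈ ({a, b} : Set A), x ≤ b := by
      rintro x (hx | hx) <;> simp_all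
    exact fun x hx y hy => ⟨b, by simp, hle x hx, hle y hy⟩
  · exact ⟨by rintro x (hx | hx) <;> simp_all, fun c hc => hc (by simp)⟩

lemma IsNormalMap.isLUB_range {A B ι : Type*} [Preorder A] [Preorder B] [Preorder ι]
    [IsDirectedOrder ι] [Nonempty ι] {f : A → B} (hf : IsNormalMap f) {a : ι → A} {s : A}
    (ha : Monotone a) (hs : IsLUB (Set.range a) s) : IsLUB (Set.range fun i => f (a i)) (f s) := by
  have := hf (Set.range a) s (Set.range_nonempty a)
    (directedOn_range.2 (ha.directed_le)) hs
  rwa [← Set.range_comp] at this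

/-- The representation `σ` is strongly normal if `σ (a i) → σ s` strongly for every increasing
net `a` with supremum `s`.  This is equivalent to normality, and better suited to calculations. -/
def IsStronglyNormal (σ : M →⋆ₙₐ[ℂ] (H →L[ℂ] H)) : Prop :=
  ∀ (ι : Type u) [Preorder ι] [IsDirectedOrder ι] [Nonempty ι] (a : ι → M) (s : M), Monotone a →
    IsLUB (Set.range a) s → ∀ v, Tendsto (fun i => σ (s - a i) v) atTop (𝓝 0)

lemma IsNormalMap.isStronglyNormal {σ : M →⋆ₙₐ[ℂ] (H →L[ℂ] H)} (hσ : IsNormalMap σ) :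
    IsStronglyNormal σ := fun ι _ _ _ a s ha hs v => by
  simp only [map_sub]
  exact tendsto_apply_of_isLUB (hσ.monotone.comp ha) (hσ.isLUB_range ha hs) v

variable [StarOrderedRing M]

lemma rep_nonneg (σ : M →⋆ₙₐ[ℂ] (H →L[ℂ] H)) {a : M} (ha : 0 ≤ a) : 0 ≤ σ a := by
  obtain ⟨q, rfl⟩ := CStarAlgebra.nonneg_iff_eq_star_mul_self.1 ha
  rw [map_mul, map_star]
  exact star_mul_self_nonneg _

lemma rep_monotone (σ : M →⋆ₙₐ[ℂ] (H →L[ℂ] H)) : Monotone σ := fun a b hab => by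
  rw [← sub_nonneg, ← map_sub]
  exact rep_nonneg σ (sub_nonneg.2 hab)

lemma tendsto_rep_directedOn {σ : M →⋆ₙₐ[ℂ] (H →L[ℂ] H)} (hσ : IsStronglyNormal σ) {D : Set M}
    {s : M} (hD : D.Nonempty) (hdir : DirectedOn (· ≤ ·) D) (hs : IsLUB D s) :
    ∃ (_ : Nonempty D) (_ : IsDirectedOrder D), ∀ v,
      Tendsto (fun d : D => σ (s - d) v) atTop (𝓝 0) := by
  have : Nonempty D := hD.to_subtype
  have : IsDirectedOrder D := directedOn_iff_isDirectedOrder.1 hdir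
  exact ⟨inferInstance, inferInstance, hσ D (fun d => (d : M)) s (fun _ _ h => h) (by simpa)⟩

lemma IsStronglyNormal.isNormalMap {σ : M →⋆ₙₐ[ℂ] (H →L[ℂ] H)} (hσ : IsStronglyNormal σ) :
    IsNormalMap σ := fun D s hD hdir hs => by
  obtain ⟨_, _, h⟩ := tendsto_rep_directedOn hσ hD hdir hs
  refine ⟨?_, fun B hB => ?_⟩
  · rintro _ ⟨d, hd, rfl⟩
    exact rep_monotone σ (hs.1 hd)
  · rw [← sub_nonneg, nonneg_iff_inner_nonneg]
    intro v
    have h1 : Tendsto (fun d : D => (inner ℂ ((B - σ d) v) v : ℂ)) atTop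
        (𝓝 (inner ℂ ((B - σ s) v) v)) := by
      refine Tendsto.inner ?_ tendsto_const_nhds
      have h2 := (tendsto_const_nhds (x := (B - σ s) v)).add (h v)
      rw [add_zero] at h2
      refine h2.congr fun d => ?_
      simp
    exact ge_of_tendsto' h1 fun d => nonneg_iff_inner_nonneg.1 (sub_nonneg.2 (hB ⟨d, d.2, rfl⟩)) v

/-- Vector functionals of a normal representation are normal. -/
lemma IsStronglyNormal.isNormalMap_inner {σ : M →⋆ₙₐ[ℂ] (H →L[ℂ] H)} (hσ : IsStronglyNormal σ)
    (v : H) : IsNormalMap fun a => (inner ℂ v (σ a v) : ℂ) := fun D s hD hdir hs => by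
  obtain ⟨_, _, h⟩ := tendsto_rep_directedOn hσ hD hdir hs
  have hpos : ∀ {a}, 0 ≤ a → 0 ≤ (inner ℂ v (σ a v) : ℂ) := fun ha =>
    ((ContinuousLinearMap.nonneg_iff_isPositive _).1 (rep_nonneg σ ha)).inner_nonneg_right v
  have hmono : Monotone fun d : D => (inner ℂ v (σ d v) : ℂ) := fun d e hde => by
    have := hpos (sub_nonneg.2 (show (d : M) ≤ e from hde))
    rwa [map_sub, sub_apply, inner_sub_right, sub_nonneg] at this
  have hlim : Tendsto (fun d : D => (inner ℂ v (σ d v) : ℂ)) atTop (𝓝 (inner ℂ v (σ s v))) := by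
    refine Tendsto.inner tendsto_const_nhds ?_
    have h2 := (tendsto_const_nhds (x := σ s v)).sub (h v)
    rw [sub_zero] at h2
    refine h2.congr fun d => ?_
    simp
  have := isLUB_of_tendsto_atTop hmono hlim
  rwa [Set.image_eq_range]

/-- Strong normality can be tested on vector functionals of a total set of vectors. -/
lemma isStronglyNormal_of_total {σ : M →⋆ₙₐ[ℂ] (H →L[ℂ] H)} {T : Set H}
    (hT : (Submodule.span ℂ T).topologicalClosure = ⊤)
    (h : ∀ (ι : Type u) [Preorder ι] [IsDirectedOrder ι] [Nonempty ι] (a : ι → M) (s : M),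
      Monotone a → IsLUB (Set.range a) s → ∀ v ∈ T,
      Tendsto (fun i => (inner ℂ (σ (s - a i) v) v : ℂ)) atTop (𝓝 0)) :
    IsStronglyNormal σ := by
  intro ι _ _ _ a s ha hs v
  let i₀ : ι := Classical.arbitrary ι
  have hpos : ∀ i, 0 ≤ s - a i := fun i => sub_nonneg.2 (hs.1 ⟨i, rfl⟩)
  have hbd : ∀ i, i₀ ≤ i → ‖σ (s - a i)‖ ≤ ‖σ (s - a i₀)‖ := fun i hi =>
    CStarAlgebra.norm_le_norm_of_nonneg_of_le (rep_nonneg σ (hpos i))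
      (rep_monotone σ (sub_le_sub_left (ha hi) s))
  let N : Submodule ℂ H :=
    { carrier := {v | Tendsto (fun i => σ (s - a i) v) atTop (𝓝 0)}
      add_mem' := fun {v w} hv hw => by
        simpa only [Set.mem_ofPred_eq, map_add, add_zero] using Tendsto.add hv hw
      zero_mem' := by simp
      smul_mem' := fun c v hv => by
        simpa only [Set.mem_ofPred_eq, map_smul, smul_zero] using Tendsto.const_smul hv c }
  have hN : IsClosed (N : Set H) := by
    rw [← isSeqClosed_iff_isClosed]
    intro u v hu huv
    change Tendsto (fun i => σ (s - a i) v) atTop (𝓝 0)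
    rw [Metric.tendsto_nhds]
    intro ε hε
    obtain ⟨n, hn⟩ := (Metric.tendsto_nhds.1 huv (ε / 2 / (‖σ (s - a i₀)‖ + 1))
      (by positivity)).exists
    filter_upwards [Metric.tendsto_nhds.1 (hu n) (ε / 2) (by positivity),
      eventually_ge_atTop i₀] with i hi hi₀
    rw [dist_zero_right] at hi ⊢
    have h1 : ‖σ (s - a i) (v - u n)‖ ≤ ε / 2 := by
      rw [dist_comm, dist_eq_norm, lt_div_iff₀ (by positivity)] at hn
      refine ((σ (s - a i)).le_of_opNorm_le (hbd i hi₀) _).trans ?_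
      nlinarith [norm_nonneg (v - u n)]
    have h2 : σ (s - a i) v = σ (s - a i) (v - u n) + σ (s - a i) (u n) := by
      rw [← map_add, sub_add_cancel]
    rw [h2]
    linarith [norm_add_le (σ (s - a i) (v - u n)) (σ (s - a i) (u n))]
  have hTN : (Submodule.span ℂ T).topologicalClosure ≤ N := by
    refine Submodule.topologicalClosure_minimal _ (Submodule.span_le.2 fun v hv => ?_) hN
    change Tendsto (fun i => σ (s - a i) v) atTop (𝓝 0)
    rw [tendsto_zero_iff_norm_tendsto_zero]
    have h1 : Tendsto (fun i => (inner ℂ (σ (s - a i) v) v : ℂ).re) atTop (𝓝 0) := by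
      simpa only [Complex.zero_re] using!
        (Complex.continuous_re.tendsto 0).comp (h ι a s ha hs v hv)
    have h2 : Tendsto (fun i => √(‖σ (s - a i₀)‖ * (inner ℂ (σ (s - a i) v) v : ℂ).re)) atTop
        (𝓝 0) := by
      simpa using (h1.const_mul ‖σ (s - a i₀)‖).sqrt
    refine squeeze_zero' (Eventually.of_forall fun i => norm_nonneg _) ?_ h2
    filter_upwards [eventually_ge_atTop i₀] with i hi
    refine Real.le_sqrt_of_sq_le ((norm_apply_sq_le_of_nonneg (rep_nonneg σ (hpos i)) v).trans ?_)
    gcongr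
    · exact (Complex.nonneg_iff.1 (nonneg_iff_inner_nonneg.1 (rep_nonneg σ (hpos i)) v)).1
    · exact hbd i hi
  rw [hT] at hTN
  exact hTN Submodule.mem_top

end Normality

/-! ### Totality in the W*-setting -/

section SigmaTotality

open Filter Topology

/-- An approximate polar decomposition `x = u · b` with `‖u‖ ≤ 1` and `b² = ⟨x, x⟩ + δ`. -/
lemma exists_polar {M : Type u} [CStarAlgebra M] [PartialOrder M] [StarOrderedRing M]
    {X : Type v} [NormedAddCommGroup X] [NormedSpace ℂ X] [SMul Mᵐᵒᵖ X] [CStarModule Mᵐᵒᵖ X]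
    (x : X) {δ : ℝ} (hδ : 0 < δ) :
    ∃ (b : M) (u : X), star b = b ∧ b * b = mip M x x + δ • (1 : M) ∧ op b • u = x ∧ ‖u‖ ≤ 1 := by
  have h0 : (0 : M) ≤ δ • (1 : M) := smul_nonneg hδ.le zero_le_one
  have ha : 0 ≤ mip M x x + δ • (1 : M) := add_nonneg (mip_self_nonneg x) h0
  set b : M := CFC.sqrt (mip M x x + δ • (1 : M)) with hb
  have hbb : b * b = mip M x x + δ • (1 : M) := CFC.sqrt_mul_sqrt_self _ ha
  have hbs : star b = b := (CFC.sqrt_nonneg _).isSelfAdjoint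
  have hu : IsUnit (b * b) := by
    rw [hbb]
    refine CStarAlgebra.isUnit_of_le (δ • (1 : M)) (le_add_of_nonneg_left (mip_self_nonneg x)) ?_
    exact IsStrictlyPositive.smul hδ isStrictlyPositive_one
  have hub : IsUnit b := by
    rw [← pow_two] at hu
    exact (isUnit_pow_iff two_ne_zero).1 hu
  obtain ⟨c, hbc, hcb⟩ := isUnit_iff_exists.1 hub
  have hcs : star c = c := by
    have h1 : star c * b = 1 := by rw [← hbs, ← star_mul, hbc, star_one]
    calc star c = star c * (b * c) := by rw [hbc, mul_one]
      _ = c := by rw [← mul_assoc, h1, one_mul]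
  refine ⟨b, op c • x, hbs, hbb, mip_ext (M := M) fun z => ?_, ?_⟩
  · rw [mip_op_right, mip_op_right, mul_assoc, hcb, mul_one]
  · rw [← sq_le_one_iff₀ (norm_nonneg _), ← norm_mip_self (M := M), mip_op_right, mip_op_left]
    have h1 : star c * mip M x x * c ≤ 1 := by
      have h2 : star c * mip M x x * c ≤ star c * (b * b) * c :=
        star_left_conjugate_le_conjugate (hbb ▸ le_add_of_nonneg_right h0) c
      have h3 : star c * (b * b) * c = 1 := by
        rw [hcs, ← mul_assoc, hcb, one_mul, hbc]
      rwa [h3] at h2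
    have h4 : 0 ≤ star c * mip M x x * c := star_left_conjugate_nonneg (mip_self_nonneg x) c
    refine (CStarAlgebra.norm_le_norm_of_nonneg_of_le h4 h1).trans ?_
    rcases subsingleton_or_nontrivial M with h | h
    · rw [Subsingleton.elim (1 : M) 0, norm_zero]; exact zero_le_one
    · rw [CStarRing.norm_one]

variable {M : Type u} [NonUnitalCStarAlgebra M] [PartialOrder M] [StarOrderedRing M]
  {X : Type v} [NormedAddCommGroup X] [NormedSpace ℂ X] [SMul Mᵐᵒᵖ X] [CStarModule Mᵐᵒᵖ X]
  {H : Type*} [NormedAddCommGroup H] [InnerProductSpace ℂ H] [CompleteSpace H]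

/-- The vector functional `a ↦ ⟨v, σ(a) v⟩`. -/
def vectorFunctional (σ : M →⋆ₙₐ[ℂ] (H →L[ℂ] H)) (v : H) : M →L[ℂ] ℂ :=
  LinearMap.mkContinuous
    { toFun := fun a => inner ℂ v (σ a v)
      map_add' := fun a b => by simp
      map_smul' := fun c a => by simp } (‖v‖ ^ 2) fun a => by
    refine (norm_inner_le_norm _ _).trans ?_
    have := (σ a).le_of_opNorm_le (NonUnitalStarAlgHom.norm_apply_le σ a) v
    calc ‖v‖ * ‖σ a v‖ ≤ ‖v‖ * (‖a‖ * ‖v‖) := by gcongr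
      _ = _ := by ring

lemma norm_vectorFunctional_le (σ : M →⋆ₙₐ[ℂ] (H →L[ℂ] H)) (v : H) :
    ‖vectorFunctional σ v‖ ≤ ‖v‖ ^ 2 :=
  LinearMap.mkContinuous_norm_le _ (by positivity) _

/-- The totality condition of `IsSigmaTotal`, for functionals that are sums over any countably
infinite set. -/
lemma IsSigmaTotal.tsum_eq_zero {s : Set X} (hs : IsSigmaTotal M s) {ι : Type*} [Countable ι]
    [Infinite ι]
    (ω : ι → M →L[ℂ] ℂ) (η : ι → X) (hpos : ∀ i a, 0 ≤ a → 0 ≤ ω i a)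
    (hnormal : ∀ i, IsNormalMap (ω i)) (hsum : Summable fun i => ‖ω i‖ * ‖η i‖)
    (h0 : ∀ x ∈ s, ∑' i, ω i (mip M (η i) x) = 0) (x : X) : ∑' i, ω i (mip M (η i) x) = 0 := by
  obtain ⟨_⟩ := nonempty_denumerable ι
  let e : ℕ ≃ ι := (Denumerable.eqv ι).symm
  have h1 : ∀ x, ∑' n, ω (e n) (mip M (η (e n)) x) = ∑' i, ω i (mip M (η i) x) := fun x =>
    e.tsum_eq fun i => ω i (mip M (η i) x)
  rw [← h1]
  refine hs (fun n => ω (e n)) (fun n => η (e n)) (fun n => hpos _) (fun n => hnormal _)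
    (e.summable_iff.2 hsum) (fun x hx => ?_) x
  rw [h1, h0 x hx]

lemma inner_map_polarization_sum (T : H →L[ℂ] H) (p q : H) :
    inner ℂ p (T q) = ∑ j : Fin 4, ((-Complex.I) ^ (j : ℕ) / 4 : ℂ) *
      inner ℂ (p + Complex.I ^ (j : ℕ) • q) (T (p + Complex.I ^ (j : ℕ) • q)) := by
  have h3 : Complex.I ^ 3 = -Complex.I := by rw [pow_succ, Complex.I_sq]; ring
  have h3' : (-Complex.I) ^ 3 = Complex.I := by rw [Odd.neg_pow (by decide), h3, neg_neg]
  simp only [Fin.sum_univ_four, Fin.val_zero, Fin.val_one, Fin.val_two,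
    show ((3 : Fin 4) : ℕ) = 3 from rfl, pow_zero, pow_one, neg_sq, Complex.I_sq, h3, h3', map_add,
    map_smul, inner_add_left, inner_add_right, inner_smul_left, inner_smul_right, map_neg, map_one,
    Complex.conj_I]
  ring_nf
  simp only [Complex.I_sq]
  ring

/-- In the W*-setting, elementary tensors `x ⊗ h` with `x` in a σ-total set are total in `X ⊗_σ H`,
for a normal representation `σ`.  For fixed `h`, the functional `x ↦ ⟨ξ, x ⊗ h⟩` is a norm
convergent series of functionals `x ↦ ⟨xₙ ⊗ h, x ⊗ h⟩`.  With the approximate polar decomposition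
`xₙ = uₙ · bₙ` these become `x ↦ ⟨σ(bₙ) h, σ(⟨uₙ, x⟩) h⟩`, where `‖uₙ‖ ≤ 1` and `σ(bₙ) h` is small,
so polarization expresses them through positive normal functionals with summable norms. -/
lemma IsSigmaTotal.eq_zero_of_inner_eq_zero (hM : IsAStarAlgebra .wstar M) {s : Set X}
    (hs : IsSigmaTotal M s) {σ : M →⋆ₙₐ[ℂ] (H →L[ℂ] H)} (hσ : IsStronglyNormal σ)
    (ξ : HilbertTensor X σ) (h0 : ∀ x ∈ s, ∀ h, inner ℂ ξ (htmul σ x h) = 0) : ξ = 0 := by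
  obtain ⟨c, rfl, -⟩ := hM
  refine HilbertTensor.ext_inner_htmul fun x h => ?_
  rw [inner_zero_left]
  let N : Submodule ℂ (HilbertTensor X σ) :=
    (LinearMap.range (HilbertTensor.htmulL (X := X) σ h).toLinearMap).topologicalClosure
  have : CompleteSpace N := (Submodule.isClosed_topologicalClosure _).completeSpace_coe
  set ξ' : HilbertTensor X σ := N.starProjection ξ with hξ'
  have hproj : ∀ y, inner ℂ ξ (htmul σ y h) = inner ℂ ξ' (htmul σ y h) := fun y => by
    have hy : htmul σ y h ∈ N := Submodule.le_topologicalClosure _ ⟨y, rfl⟩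
    rw [hξ', Submodule.inner_starProjection_left_eq_right,
      Submodule.starProjection_eq_self_iff.2 hy]
  have hmem : ξ' ∈ closure ((LinearMap.range
      (HilbertTensor.htmulL (X := X) σ h).toLinearMap).toAddSubgroup : Set (HilbertTensor X σ)) :=
    N.starProjection_apply_mem ξ
  obtain ⟨z, hz, hzmem, -, hzn⟩ := controlled_sum_of_mem_closure hmem
    (b := fun n => (1 / 4 : ℝ) ^ n) (fun n => by positivity)
  choose y hy using hzmem
  replace hy : ∀ n, htmul σ (y n) h = z n := hy
  obtain ⟨C, hC0, hC⟩ : ∃ C : ℝ, 0 ≤ C ∧ ∀ n, ‖z n‖ ≤ C * (1 / 4) ^ n := by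
    refine ⟨‖z 0‖ + 1, by positivity, fun n => ?_⟩
    rcases n.eq_zero_or_pos with rfl | hn
    · simp
    · refine (hzn n hn).le.trans (le_mul_of_one_le_left (by positivity) ?_)
      linarith [norm_nonneg (z 0)]
  choose b u hbs hbb hbu hu using fun n => exists_polar (M := M) (y n)
    (show (0 : ℝ) < ((1 / 4) ^ n) ^ 2 by positivity)
  have hσ1 : ∀ a : M, ∀ e, ‖σ a e‖ ≤ ‖a‖ * ‖e‖ := fun a e =>
    (σ a).le_of_opNorm_le (NonUnitalStarAlgHom.norm_apply_le σ a) e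
  have hinner : ∀ n (a : M),
      inner ℂ (σ (b n) h) (σ a h) = inner ℂ h (σ (b n * a) h) := fun n a => by
    rw [← ContinuousLinearMap.adjoint_inner_right, ← ContinuousLinearMap.star_eq_adjoint,
      ← map_star, hbs, map_mul]
    rfl
  -- the vectors `σ(bₙ) h` are small
  have hbh : ∀ n, ‖σ (b n) h‖ ≤ (C + ‖(1 : M)‖ * ‖h‖ + ‖h‖) * (1 / 4) ^ n := fun n => by
    rw [← sq_le_sq₀ (norm_nonneg _) (by positivity)]
    have h1 : ‖σ (b n) h‖ ^ 2 = ‖z n‖ ^ 2 +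
        ((1 / 4 : ℝ) ^ n) ^ 2 * (inner ℂ h (σ 1 h) : ℂ).re := by
      rw [← inner_self_eq_norm_sq (𝕜 := ℂ), hinner, hbb, ← hy, ← inner_self_eq_norm_sq (𝕜 := ℂ),
        inner_htmul, ← Complex.coe_smul, map_add, map_smul, add_apply, smul_apply,
        inner_add_right, inner_smul_right, map_add]
      congr 1
      exact Complex.re_ofReal_mul _ _
    have h2 : (inner ℂ h (σ 1 h) : ℂ).re ≤ ‖(1 : M)‖ * ‖h‖ * ‖h‖ := by
      refine (Complex.re_le_norm _).trans ((norm_inner_le_norm _ _).trans ?_)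
      have := hσ1 1 h
      nlinarith [norm_nonneg h]
    have h3 : ‖z n‖ ^ 2 ≤ (C * (1 / 4) ^ n) ^ 2 := pow_le_pow_left₀ (norm_nonneg _) (hC n) 2
    have h4 : 0 ≤ ‖(1 : M)‖ * ‖h‖ := by positivity
    rw [h1, mul_pow]
    rw [mul_pow] at h3
    have h5 : (0 : ℝ) ≤ ((1 / 4 : ℝ) ^ n) ^ 2 := by positivity
    have h6 : C ^ 2 + ‖(1 : M)‖ * ‖h‖ * ‖h‖ ≤ (C + ‖(1 : M)‖ * ‖h‖ + ‖h‖) ^ 2 := by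
      nlinarith [norm_nonneg h, mul_nonneg hC0 h4, mul_nonneg hC0 (norm_nonneg h),
        mul_nonneg h4 (norm_nonneg h)]
    nlinarith [mul_le_mul_of_nonneg_left h6 h5, mul_le_mul_of_nonneg_left h2 h5]
  set D : ℝ := C + ‖(1 : M)‖ * ‖h‖ + ‖h‖ with hD
  -- the two arguments of the polarization are scaled so that both are of size `2⁻ⁿ`
  let w : ℕ × Fin 4 → H := fun i =>
    (2 : ℂ) ^ i.1 • σ (b i.1) h + Complex.I ^ (i.2 : ℕ) • ((1 / 2 : ℂ) ^ i.1 • h)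
  let ω : ℕ × Fin 4 → M →L[ℂ] ℂ := fun i => vectorFunctional σ (w i)
  let η : ℕ × Fin 4 → X := fun i => star ((-Complex.I) ^ (i.2 : ℕ) / 4) • u i.1
  have hterm : ∀ n x, ∑ j, ω (n, j) (mip M (η (n, j)) x) = inner ℂ (z n) (htmul σ x h) := by
    intro n x
    have h1 : inner ℂ (z n) (htmul σ x h) = inner ℂ ((2 : ℂ) ^ n • σ (b n) h)
        (σ (mip M (u n) x) ((1 / 2 : ℂ) ^ n • h)) := by
      rw [map_smul, inner_smul_left, inner_smul_right, hinner, ← mul_assoc, map_pow,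
        Complex.conj_ofNat, ← mul_pow, mul_one_div_cancel two_ne_zero, one_pow, one_mul, ← hy,
        inner_htmul, ← hbs n, ← mip_op_left, hbu]
    rw [h1, inner_map_polarization_sum]
    refine Finset.sum_congr rfl fun j _ => ?_
    simp only [η, mip_smul_left, star_star, map_smul, smul_eq_mul]
    rfl
  have hw : ∀ i, ‖w i‖ ≤ (D + ‖h‖) * (1 / 2) ^ i.1 := fun i => by
    refine (norm_add_le _ _).trans ?_
    rw [norm_smul, norm_smul, norm_smul, norm_pow, norm_pow, norm_pow, Complex.norm_I, one_pow,
      one_mul, norm_div, norm_one, Complex.norm_ofNat, add_mul, mul_comm _ ‖h‖]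
    refine add_le_add ?_ le_rfl
    calc (2 : ℝ) ^ i.1 * ‖σ (b i.1) h‖ ≤ 2 ^ i.1 * (D * (1 / 4) ^ i.1) := by
          gcongr; exact hbh i.1
      _ = D * (1 / 2) ^ i.1 := by
          rw [mul_left_comm, ← mul_pow]; norm_num
  have hη : ∀ i, ‖η i‖ ≤ 1 := fun i => by
    simp only [η, norm_smul, norm_star, norm_div, norm_pow, norm_neg, Complex.norm_I,
      one_pow, Complex.norm_ofNat]
    linarith [hu i.1, norm_nonneg (u i.1)]
  have hsum : Summable fun i => ‖ω i‖ * ‖η i‖ := by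
    have hg : Summable fun i : ℕ × Fin 4 => (D + ‖h‖) ^ 2 * (1 / 4 : ℝ) ^ i.1 := by
      rw [summable_prod_of_nonneg (fun i => by positivity)]
      refine ⟨fun n => Summable.of_finite, ?_⟩
      simp only [tsum_fintype, Finset.sum_const]
      exact ((summable_geometric_of_lt_one (by norm_num) (by norm_num)).mul_left _).const_smul _
    refine Summable.of_nonneg_of_le (fun i => by positivity) (fun i => ?_) hg
    calc ‖ω i‖ * ‖η i‖ ≤ ‖w i‖ ^ 2 * 1 := by
          gcongr
          · exact norm_vectorFunctional_le σ (w i)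
          · exact hη i
      _ ≤ ((D + ‖h‖) * (1 / 2) ^ i.1) ^ 2 := by
          rw [mul_one]; exact pow_le_pow_left₀ (norm_nonneg _) (hw i) 2
      _ = _ := by rw [mul_pow, ← pow_mul, mul_comm i.1 2, pow_mul]; norm_num
  have htsum : ∀ x, ∑' i, ω i (mip M (η i) x) = inner ℂ ξ (htmul σ x h) := fun x => by
    have h1 : Summable fun i => ω i (mip M (η i) x) := by
      refine Summable.of_norm_bounded (hsum.mul_right ‖x‖) fun i => ?_
      refine ((ω i).le_opNorm _).trans ?_
      rw [mul_assoc]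
      gcongr
      exact CStarModule.norm_inner_le (A := Mᵐᵒᵖ) X
    rw [h1.tsum_prod, hproj]
    simp only [tsum_fintype, hterm]
    have h2 : Summable z := Summable.of_norm_bounded
      ((summable_geometric_of_lt_one (r := 1 / 4) (by norm_num) (by norm_num)).mul_left C) hC
    have h3 : HasSum z ξ' := by
      rw [h2.hasSum_iff_tendsto_nat]
      exact (tendsto_add_atTop_iff_nat 1).1 hz
    exact (h3.mapL (innerSLFlip ℂ (htmul σ x h))).tsum_eq
  rw [← htsum]
  refine hs.tsum_eq_zero ω η (fun i a ha => ?_) (fun i => hσ.isNormalMap_inner (w i)) hsum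
    (fun x hx => ?_) x
  · exact ((ContinuousLinearMap.nonneg_iff_isPositive _).1 (rep_nonneg σ ha)).inner_nonneg_right _
  · rw [htsum, h0 x hx]

end SigmaTotality

/-! ### The coisometry onto `X (n + m) ⊗_ψ E` -/

namespace IsCoisometricProduct

variable {k : AStarKind} {M : Type u} [NonUnitalCStarAlgebra M] [PartialOrder M]
  [StarOrderedRing M]
  {X Y Z : AStarCorrespondence.{u, v} k M} {μ : X →ₗ[ℂ] Y →ₗ[ℂ] Z}
  {E : Type w} [NormedAddCommGroup E] [InnerProductSpace ℂ E] [CompleteSpace E]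

/-- If `μ x y = U (x ⊗ y)` with a coisometric bimodule map `U`, then
`x ⊗ (y ⊗ h) ↦ μ x y ⊗ h` is a coisometry from `X ⊗ (Y ⊗_ψ E)` to `Z ⊗_ψ E`. -/
lemma exists_coisometry (hM : IsAStarAlgebra k M) (hμ : IsCoisometricProduct μ)
    (ψ : M →⋆ₙₐ[ℂ] (E →L[ℂ] E)) (hψ : k = .wstar → IsStronglyNormal ψ) :
    ∃ W : HilbertTensor X (Y.leftRep ψ) →L[ℂ] HilbertTensor Z ψ,
      (∀ x y h, W (htmul (Y.leftRep ψ) x (htmul ψ y h)) = htmul ψ (μ x y) h) ∧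
      W ∘L W.adjoint = .id ℂ _ := by
  obtain ⟨K, t, U, ht, hU, hUt⟩ := hμ
  obtain ⟨V, hV, hVV⟩ := hU.exists_tensor ψ
  have hJ : ht.assoc ψ ∘L (ht.assoc ψ).adjoint = .id ℂ _ := by
    refine comp_adjoint_eq_id_of_denseRange _ (ht.inner_assoc ψ) (ht.denseRange_assoc ψ ?_)
    intro ξ hξ
    cases k with
    | cstar => exact ht.eq_zero_of_inner_eq_zero_of_cstar rfl ψ ξ hξ
    | wstar =>
      refine (ht.total_sigma rfl).eq_zero_of_inner_eq_zero hM (hψ rfl) ξ ?_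
      rintro _ ⟨x, y, rfl⟩ h
      exact hξ x y h
  refine ⟨V ∘L ht.assoc ψ, fun x y h => ?_, ?_⟩
  · rw [ContinuousLinearMap.comp_apply, ht.assoc_htmul, ht.leftMul_htmul, hV, hUt]
  · rw [ContinuousLinearMap.adjoint_comp]
    calc _ = V ∘L (ht.assoc ψ ∘L (ht.assoc ψ).adjoint) ∘L V.adjoint := rfl
      _ = _ := by rw [hJ, ContinuousLinearMap.id_comp, hVV]

end IsCoisometricProduct

lemma norm_apply_le_of_comp_adjoint_eq_id {H K : Type*} [NormedAddCommGroup H]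
    [InnerProductSpace ℂ H] [CompleteSpace H] [NormedAddCommGroup K] [InnerProductSpace ℂ K]
    [CompleteSpace K] {W : H →L[ℂ] K} (hW : W ∘L W.adjoint = .id ℂ K) (x : H) : ‖W x‖ ≤ ‖x‖ := by
  have h1 : ∀ y, ‖W.adjoint y‖ = ‖y‖ := fun y => by
    rw [← sq_eq_sq₀ (norm_nonneg _) (norm_nonneg _), ← inner_self_eq_norm_sq (𝕜 := ℂ),
      ContinuousLinearMap.adjoint_inner_left, ← inner_self_eq_norm_sq (𝕜 := ℂ) y]
    congr 2
    exact DFunLike.congr_fun hW y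
  have h2 : ‖W x‖ ^ 2 ≤ ‖W x‖ * ‖x‖ := by
    rw [← inner_self_eq_norm_sq (𝕜 := ℂ), ← ContinuousLinearMap.adjoint_inner_left]
    refine (Complex.re_le_norm _).trans ((norm_inner_le_norm _ _).trans ?_)
    rw [h1]
  by_contra! h
  nlinarith [norm_nonneg x]

/-! ### Subrepresentations -/

section SubRep

variable {M : Type u} [NonUnitalCStarAlgebra M]
  {H : Type*} [NormedAddCommGroup H] [InnerProductSpace ℂ H] [CompleteSpace H]

lemma inner_rep_left (σ : M →⋆ₙₐ[ℂ] (H →L[ℂ] H)) (a : M) (x y : H) :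
    inner ℂ (σ a x) y = inner ℂ x (σ (star a) y) := by
  rw [map_star, ContinuousLinearMap.star_eq_adjoint, ContinuousLinearMap.adjoint_inner_right]

/-- A representation is nondegenerate if and only if it annihilates no nonzero vector. -/
lemma rep_nondegenerate_iff (σ : M →⋆ₙₐ[ℂ] (H →L[ℂ] H)) :
    (Submodule.span ℂ {z : H | ∃ a h, z = σ a h}).topologicalClosure = ⊤ ↔
      ∀ v, (∀ a, σ a v = 0) → v = 0 := by
  rw [Submodule.topologicalClosure_eq_top_iff, Submodule.eq_bot_iff]
  refine forall_congr' fun v => imp_congr_left ?_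
  rw [Submodule.mem_orthogonal]
  constructor
  · intro h a
    have := h (σ (star a) (σ a v)) (Submodule.subset_span ⟨_, _, rfl⟩)
    rwa [inner_rep_left, star_star, inner_self_eq_zero] at this
  · intro h z hz
    induction hz using Submodule.span_induction with
    | mem z hz =>
      obtain ⟨a, e, rfl⟩ := hz
      rw [inner_rep_left, h, inner_zero_right]
    | zero => simp
    | add x y _ _ hx hy => rw [inner_add_left, hx, hy, add_zero]
    | smul c x _ hx => rw [inner_smul_left, hx, mul_zero]

/-- The restriction of a representation to an invariant subspace. -/
def subRep (σ : M →⋆ₙₐ[ℂ] (H →L[ℂ] H)) (W : Submodule ℂ H) [CompleteSpace W]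
    (hW : ∀ a, ∀ v ∈ W, σ a v ∈ W) : M →⋆ₙₐ[ℂ] (W →L[ℂ] W) where
  toFun a := ((σ a) ∘L W.subtypeL).codRestrict W fun v => hW a v v.2
  map_smul' c a := by
    ext v
    change σ (c • a) v = c • σ a v
    rw [map_smul, smul_apply]
  map_zero' := by ext v; simp
  map_add' a b := by
    ext v
    change σ (a + b) v = σ a v + σ b v
    rw [map_add, add_apply]
  map_mul' a b := by
    ext v
    change σ (a * b) v = σ a (σ b v)
    rw [map_mul, mul_apply_eq_comp]
  map_star' a := by
    ext1 v
    refine ext_inner_right ℂ fun w => ?_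
    rw [ContinuousLinearMap.star_eq_adjoint, ContinuousLinearMap.adjoint_inner_left]
    have := inner_rep_left σ (star a) v w
    rwa [star_star] at this

@[simp] lemma coe_subRep_apply (σ : M →⋆ₙₐ[ℂ] (H →L[ℂ] H)) (W : Submodule ℂ H) [CompleteSpace W]
    (hW : ∀ a, ∀ v ∈ W, σ a v ∈ W) (a : M) (v : W) : (subRep σ W hW a v : H) = σ a v := rfl

lemma IsStronglyNormal.subRep [PartialOrder M] {σ : M →⋆ₙₐ[ℂ] (H →L[ℂ] H)}
    (hσ : IsStronglyNormal σ) (W : Submodule ℂ H) [CompleteSpace W]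
    (hW : ∀ a, ∀ v ∈ W, σ a v ∈ W) : IsStronglyNormal (subRep σ W hW) :=
  fun ι _ _ _ a s ha hs v => by
    have h1 := hσ ι a s ha hs v
    rw [tendsto_zero_iff_norm_tendsto_zero] at h1 ⊢
    exact h1

end SubRep

/-! ### The representation of `M` on the Fock space, and composition of shifts -/

namespace SubproductSystem

variable {k : AStarKind} {M : Type u} [NonUnitalCStarAlgebra M] [PartialOrder M]
  [StarOrderedRing M] (S : SubproductSystem.{u, v} k M)
  {E : Type w} [NormedAddCommGroup E] [InnerProductSpace ℂ E] [CompleteSpace E]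
  (ψ : AStarRep k M E)

lemma span_single_htmul : (Submodule.span ℂ {z : S.FockTensor ψ |
    ∃ (m : ℕ) (η : S.X m) (h : E), z = lp.single 2 m (htmul ψ.toHom η h)}).topologicalClosure =
      ⊤ := by
  rw [Submodule.topologicalClosure_eq_top_iff, Submodule.eq_bot_iff]
  intro ξ hξ
  ext1
  funext m
  refine HilbertTensor.ext_inner_htmul fun η h => ?_
  have h1 := hξ _ (Submodule.subset_span ⟨m, η, h, rfl⟩)
  rw [lp.inner_single_left, inner_eq_zero_symm] at h1
  rw [h1]
  exact (inner_zero_left _).symm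

lemma fock_clm_ext {F : Type*} [NormedAddCommGroup F] [NormedSpace ℂ F]
    {f g : S.FockTensor ψ →L[ℂ] F} (h : ∀ (m : ℕ) (η : S.X m) (e : E),
      f (lp.single 2 m (htmul ψ.toHom η e)) = g (lp.single 2 m (htmul ψ.toHom η e))) : f = g := by
  refine ContinuousLinearMap.ext_on (Submodule.dense_iff_topologicalClosure_eq_top.2
    (S.span_single_htmul ψ)) ?_
  rintro _ ⟨m, η, e, rfl⟩
  exact h m η e

lemma single_htmul_congr {m m' : ℕ} (hm : m = m') {η : S.X m} {η' : S.X m'} (hη : HEq η η')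
    (h : E) : (lp.single 2 m (htmul ψ.toHom η h) : S.FockTensor ψ) =
      lp.single 2 m' (htmul ψ.toHom η' h) := by
  subst hm
  rw [eq_of_heq hη]

lemma shift_mul {n m : ℕ} (ζ : S.X n) (η : S.X m) :
    S.shift ψ (S.mul n m ζ η) = S.shift ψ ζ ∘L S.shift ψ η :=
  S.fock_clm_ext ψ fun l x h => by
    rw [ContinuousLinearMap.comp_apply, shift_single, shift_single, shift_single]
    exact S.single_htmul_congr ψ (add_assoc n m l) (S.mul_assoc n m l ζ η x) h

lemma shift_apply_add {n : ℕ} (ζ : S.X n) (ξ : S.FockTensor ψ) (m : ℕ) :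
    (S.shift ψ ζ ξ) (n + m) = S.creationTensor ψ rfl ζ (ξ m) :=
  S.shiftFun_of_eq ψ ζ ξ rfl

lemma shift_apply_of_lt {n : ℕ} (ζ : S.X n) (ξ : S.FockTensor ψ) {l : ℕ} (hl : l < n) :
    (S.shift ψ ζ ξ) l = 0 :=
  dif_neg (by omega)

lemma creationTensor_htmul {n m : ℕ} (ζ : S.X n) (η : S.X m) (h : E) :
    S.creationTensor ψ rfl ζ (htmul ψ.toHom η h) = htmul ψ.toHom (S.mul n m ζ η) h :=
  hilbertTensorMap_htmul _ _ _ _ _ _ _ _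

lemma shift_unit_apply (a : M) (ξ : S.FockTensor ψ) (m : ℕ) :
    (S.shift ψ (S.unit a) ξ) m = (S.X m).leftRep ψ.toHom a (ξ m) := by
  have h1 : ∀ η, S.creation (zero_add m) (S.unit a) η = (S.X m).left a η := fun η => by
    refine eq_of_heq (HEq.trans ?_ (S.unit_mul m a η))
    have : ∀ {l : ℕ} (h : 0 + m = l), HEq (S.creation h (S.unit a) η) (S.mul 0 m (S.unit a) η) := by
      rintro _ rfl
      rfl
    exact this _
  have h2 : S.creationTensor ψ (zero_add m) (S.unit a) = (S.X m).leftRep ψ.toHom a :=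
    HilbertTensor.clm_ext fun η h => by
      rw [AStarCorrespondence.leftRep_htmul, ← h1]
      exact hilbertTensorMap_htmul _ _ _ _ _ _ _ _
  rw [← h2]
  exact S.shiftFun_of_eq ψ (S.unit a) ξ (zero_add m)

/-- The representation of `M` on `F_X ⊗_ψ E` by the left action, that is, by the shifts of
degree `0`. -/
def fockRep : M →⋆ₙₐ[ℂ] (S.FockTensor ψ →L[ℂ] S.FockTensor ψ) where
  toFun a := S.shift ψ (S.unit a)
  map_smul' c a := by
    ext ξ : 1; ext1; funext m
    change (S.shift ψ (S.unit (c • a)) ξ) m = c • (S.shift ψ (S.unit a) ξ) m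
    rw [shift_unit_apply, shift_unit_apply, map_smul, smul_apply]
  map_zero' := by
    ext ξ : 1; ext1; funext m
    change (S.shift ψ (S.unit 0) ξ) m = 0
    rw [shift_unit_apply, map_zero, zero_apply]
  map_add' a b := by
    ext ξ : 1; ext1; funext m
    change (S.shift ψ (S.unit (a + b)) ξ) m =
      (S.shift ψ (S.unit a) ξ) m + (S.shift ψ (S.unit b) ξ) m
    rw [shift_unit_apply, shift_unit_apply, shift_unit_apply, map_add, add_apply]
  map_mul' a b := by
    ext ξ : 1; ext1; funext m
    change (S.shift ψ (S.unit (a * b)) ξ) m = (S.shift ψ (S.unit a) (S.shift ψ (S.unit b) ξ)) m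
    rw [shift_unit_apply, shift_unit_apply, shift_unit_apply, map_mul, mul_apply_eq_comp]
  map_star' a := by
    ext1 ξ
    refine ext_inner_right ℂ fun ξ' => ?_
    rw [ContinuousLinearMap.star_eq_adjoint, ContinuousLinearMap.adjoint_inner_left,
      lp.inner_eq_tsum, lp.inner_eq_tsum]
    refine tsum_congr fun m => ?_
    rw [shift_unit_apply, shift_unit_apply, inner_rep_left, star_star]

lemma fockRep_apply (a : M) : S.fockRep ψ a = S.shift ψ (S.unit a) := rfl

lemma fockRep_single_htmul (a : M) {m : ℕ} (η : S.X m) (h : E) :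
    S.fockRep ψ a (lp.single 2 m (htmul ψ.toHom η h)) =
      lp.single 2 m (htmul ψ.toHom ((S.X m).left a η) h) := by
  rw [fockRep_apply, shift_single]
  exact S.single_htmul_congr ψ (zero_add m) (S.unit_mul m a η) h

lemma fockRep_nondegenerate (ξ : S.FockTensor ψ) (hξ : ∀ a, S.fockRep ψ a ξ = 0) : ξ = 0 := by
  ext1
  funext m
  refine HilbertTensor.ext_inner_htmul fun η h => ?_
  refine Eq.trans ?_ (inner_zero_left _).symm
  let f : S.X m →L[ℂ] ℂ := innerSL ℂ (ξ m) ∘L HilbertTensor.htmulL ψ.toHom h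
  have h1 : (Submodule.span ℂ {z : S.X m | ∃ a x, z = (S.X m).left a x}).topologicalClosure ≤
      LinearMap.ker f.toLinearMap := by
    refine Submodule.topologicalClosure_minimal _ (Submodule.span_le.2 ?_) f.isClosed_ker
    rintro _ ⟨a, x, rfl⟩
    change inner ℂ (ξ m) (htmul ψ.toHom ((S.X m).left a x) h) = 0
    rw [← lp.inner_single_right, ← fockRep_single_htmul, ← star_star a, ← inner_rep_left, hξ,
      inner_zero_left]
  rw [(S.X m).nondegenerate] at h1
  exact h1 (Submodule.mem_top (x := η))

lemma isStronglyNormal_fockRep (hk : k = .wstar) : IsStronglyNormal (S.fockRep ψ) := by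
  refine isStronglyNormal_of_total (S.span_single_htmul ψ) ?_
  rintro ι _ _ _ a s ha hs _ ⟨m, η, h, rfl⟩
  have hf := (S.X m).normal hk η
  have h1 := (ψ.normal hk).isStronglyNormal ι _ _ (hf.monotone.comp ha) (hf.isLUB_range ha hs) h
  have h2 := Filter.Tendsto.inner (𝕜 := ℂ) (tendsto_const_nhds (x := h)) h1
  rw [inner_zero_right] at h2
  refine h2.congr fun i => ?_
  have hsa : star (s - a i) = s - a i :=
    (IsSelfAdjoint.of_nonneg (sub_nonneg.2 (hs.1 ⟨i, rfl⟩))).star_eq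
  rw [fockRep_single_htmul, lp.inner_single_left, lp.single_apply_self, inner_htmul,
    AStarCorrespondence.mip_left, hsa, map_sub (S.X m).left, sub_apply, mip_sub_right]
  rfl

end SubproductSystem

/-! ### The shift restricted to an invariant subspace -/

/-- Operators `Pₙ : Gₙ → W` with `∑ Pₙ Pₙ* = 1` form the components of a coisometry. -/
lemma exists_coisometry_of_hasSum {G : ℕ → Type*} [∀ n, NormedAddCommGroup (G n)]
    [∀ n, InnerProductSpace ℂ (G n)] [∀ n, CompleteSpace (G n)]
    {W : Type*} [NormedAddCommGroup W] [InnerProductSpace ℂ W] [CompleteSpace W]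
    (P : ∀ n, G n →L[ℂ] W) (hP : ∀ w, HasSum (fun n => ‖(P n).adjoint w‖ ^ 2) (‖w‖ ^ 2)) :
    ∃ Q : lp G 2 →L[ℂ] W, (∀ n z, Q (lp.single 2 n z) = P n z) ∧ Q ∘L Q.adjoint = .id ℂ W := by
  let K : W →ₗᵢ[ℂ] lp G 2 :=
    { toFun := fun w => ⟨fun n => (P n).adjoint w, memℓp_gen (by simpa using (hP w).summable)⟩
      map_add' := fun w w' => by ext1; funext n; exact map_add _ w w'
      map_smul' := fun c w => by ext1; funext n; exact map_smul _ c w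
      norm_map' := fun w => by
        rw [← sq_eq_sq₀ (norm_nonneg _) (norm_nonneg _), ← (hP w).tsum_eq]
        simpa using lp.norm_rpow_eq_tsum (p := 2) (E := G) (by simp)
          ⟨fun n => (P n).adjoint w, memℓp_gen (by simpa using (hP w).summable)⟩ }
  refine ⟨K.toContinuousLinearMap.adjoint, fun n z => ?_, ?_⟩
  · refine ext_inner_right ℂ fun w => ?_
    rw [ContinuousLinearMap.adjoint_inner_left, lp.inner_single_left,
      ← ContinuousLinearMap.adjoint_inner_right]
    rfl
  · ext w
    refine ext_inner_right ℂ fun w' => ?_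
    rw [ContinuousLinearMap.adjoint_adjoint, ContinuousLinearMap.comp_apply,
      ContinuousLinearMap.adjoint_inner_left]
    exact K.inner_map_map w w'

/-- A coisometry is a partial isometry. -/
lemma norm_eq_of_mem_ker_orthogonal {H K : Type*} [NormedAddCommGroup H]
    [InnerProductSpace ℂ H] [CompleteSpace H] [NormedAddCommGroup K] [InnerProductSpace ℂ K]
    [CompleteSpace K] {Q : H →L[ℂ] K} (hQ : Q ∘L Q.adjoint = .id ℂ K) {x : H}
    (hx : x ∈ (LinearMap.ker Q.toLinearMap)ᗮ) : ‖Q x‖ = ‖x‖ := by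
  have hQ' : ∀ y, Q (Q.adjoint y) = y := fun y => DFunLike.congr_fun hQ y
  have hker : Q (x - Q.adjoint (Q x)) = 0 := by rw [map_sub, hQ', sub_self]
  have h1 : inner ℂ (x - Q.adjoint (Q x)) x = 0 := hx _ hker
  rw [inner_sub_left, ContinuousLinearMap.adjoint_inner_left, sub_eq_zero] at h1
  rw [← sq_eq_sq₀ (norm_nonneg _) (norm_nonneg _), ← inner_self_eq_norm_sq (𝕜 := ℂ),
    ← inner_self_eq_norm_sq (𝕜 := ℂ) x, h1]

namespace SubproductSystem

variable {k : AStarKind} {M : Type u} [NonUnitalCStarAlgebra M] [PartialOrder M]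
  [StarOrderedRing M] (S : SubproductSystem.{u, v} k M)
  {E : Type w} [NormedAddCommGroup E] [InnerProductSpace ℂ E] [CompleteSpace E]
  (ψ : AStarRep k M E)

lemma hasSum_norm_sq (ξ : S.FockTensor ψ) : HasSum (fun m => ‖ξ m‖ ^ 2) (‖ξ‖ ^ 2) := by
  have := lp.hasSum_norm (p := 2) (by simp) ξ
  simpa using this

/-- The shift is a contractive covariant representation: `ζ ⊗ ξ ↦ (S_n(ζ) ⊗ 1) ξ` is bounded by `1`
for the norm of `X n ⊗ (F_X ⊗_ψ E)`. In each degree it is the coisometry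
`X n ⊗ (X m ⊗_ψ E) → X (n + m) ⊗_ψ E`. -/
lemma norm_sum_shift_sq_le (hM : IsAStarAlgebra k M) (n : ℕ) {N : ℕ} (ζ : Fin N → S.X n)
    (ξ : Fin N → S.FockTensor ψ) : ‖∑ i, S.shift ψ (ζ i) (ξ i)‖ ^ 2 ≤
      (∑ i, ∑ j, inner ℂ (ξ i) (S.fockRep ψ (mip M (ζ i) (ζ j)) (ξ j)) : ℂ).re := by
  have hψ : k = .wstar → IsStronglyNormal ψ.toHom := fun hk => (ψ.normal hk).isStronglyNormal
  choose W hW hWW using fun m => (S.coisometric n m).exists_coisometry hM ψ.toHom hψ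
  have hW' : ∀ m x η, W m (htmul _ x η) = S.creationTensor ψ rfl x η := fun m x η => by
    have : W m ∘L HilbertTensor.htmulR _ x = S.creationTensor ψ rfl x :=
      HilbertTensor.clm_ext fun y h => by
        rw [creationTensor_htmul, ← hW]
        rfl
    rw [← this]
    rfl
  have h1 := S.hasSum_norm_sq ψ (∑ i, S.shift ψ (ζ i) (ξ i))
  have h2 : HasSum (fun m => ‖(∑ i, S.shift ψ (ζ i) (ξ i) : S.FockTensor ψ) (n + m)‖ ^ 2)
      (‖∑ i, S.shift ψ (ζ i) (ξ i)‖ ^ 2) := by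
    have h3 := (hasSum_nat_add_iff' n).2 h1
    have h0 : ∑ l ∈ Finset.range n,
        ‖(∑ i, S.shift ψ (ζ i) (ξ i) : S.FockTensor ψ) l‖ ^ 2 = 0 :=
      Finset.sum_eq_zero fun l hl => by
        rw [lp.coeFn_sum, Finset.sum_apply, Finset.sum_eq_zero, norm_zero, zero_pow two_ne_zero]
        exact fun i _ => S.shift_apply_of_lt ψ (ζ i) (ξ i) (by simpa using hl)
    rw [h0, sub_zero] at h3
    let f : ℕ → ℝ := fun l => ‖(∑ i, S.shift ψ (ζ i) (ξ i) : S.FockTensor ψ) l‖ ^ 2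
    have h5 : (fun m => f (n + m)) = fun m => f (m + n) :=
      funext fun m => congrArg f (add_comm n m)
    change HasSum (fun m => f (n + m)) _
    rw [h5]
    exact h3
  have h4 : HasSum (fun m => (∑ i, ∑ j, inner ℂ (ξ i m)
      ((S.X m).leftRep ψ.toHom (mip M (ζ i) (ζ j)) (ξ j m)) : ℂ).re)
      (∑ i, ∑ j, inner ℂ (ξ i) (S.fockRep ψ (mip M (ζ i) (ζ j)) (ξ j)) : ℂ).re := by
    refine Complex.hasSum_re (hasSum_sum fun i _ => hasSum_sum fun j _ => ?_)
    have := lp.hasSum_inner (𝕜 := ℂ) (ξ i) (S.fockRep ψ (mip M (ζ i) (ζ j)) (ξ j))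
    simpa only [fockRep_apply, shift_unit_apply] using this
  refine hasSum_le (fun m => ?_) h2 h4
  rw [← HilbertTensor.norm_sum_htmul_sq]
  refine pow_le_pow_left₀ (norm_nonneg _) ?_ 2
  refine le_trans (le_of_eq ?_) (norm_apply_le_of_comp_adjoint_eq_id (hWW m) _)
  rw [lp.coeFn_sum, Finset.sum_apply, map_sum]
  refine congrArg _ (Finset.sum_congr rfl fun i _ => ?_)
  rw [hW', shift_apply_add]

end SubproductSystem

/-! ### Covariant representations and their Poisson transform -/

/-- The operator `T n ζ` on `G`, for `ζ` in `X n`, and the representation `π` of `M` on `G` form a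
(completely contractive) covariant representation of the subproduct system `S`: the maps
`ζ ⊗ g ↦ T n ζ g` are contractions from `X n ⊗_π G` to `G`, and `T` is multiplicative and agrees
with `π` in degree `0`. -/
structure IsCovariantRep {k : AStarKind} {M : Type u} [NonUnitalCStarAlgebra M] [PartialOrder M]
    [StarOrderedRing M] (S : SubproductSystem.{u, v} k M)
    {G : Type w} [NormedAddCommGroup G] [InnerProductSpace ℂ G] [CompleteSpace G]
    (π : AStarRep k M G) (T : ∀ n, S.X n →ₗ[ℂ] G →ₗ[ℂ] G) : Prop where
  bounded : ∀ n, HilbertTensor.IsTensorBounded π.toHom (T n) 1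
  unit : ∀ a g, T 0 (S.unit a) g = π.toHom a g
  mul : ∀ n m ζ η g, T (n + m) (S.mul n m ζ η) g = T n ζ (T m η g)

namespace IsCovariantRep

variable {k : AStarKind} {M : Type u} [NonUnitalCStarAlgebra M] [PartialOrder M]
  [StarOrderedRing M] {S : SubproductSystem.{u, v} k M}
  {G : Type w} [NormedAddCommGroup G] [InnerProductSpace ℂ G] [CompleteSpace G]
  {π : AStarRep k M G} {T : ∀ n, S.X n →ₗ[ℂ] G →ₗ[ℂ] G}

lemma apply_left (hT : IsCovariantRep S π T) {n : ℕ} (a : M) (ζ : S.X n) (g : G) :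
    T n ((S.X n).left a ζ) g = π.toHom a (T n ζ g) := by
  rw [← hT.unit, ← hT.mul]
  have : ∀ {m m' : ℕ} (_ : m = m') {η : S.X m} {η' : S.X m'} (_ : HEq η η'),
      T m η g = T m' η' g := by
    rintro m _ rfl η η' h
    rw [eq_of_heq h]
  exact this (zero_add n).symm (S.unit_mul n a ζ).symm

variable (π T) in
/-- The operator `ζ ⊗ g ↦ T n ζ g` from `X n ⊗_π G` to `G`. -/
def rowOp (n : ℕ) : HilbertTensor (S.X n) π.toHom →L[ℂ] G :=
  HilbertTensor.lift π.toHom (T n)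

lemma rowOp_htmul (hT : IsCovariantRep S π T) (n : ℕ) (ζ : S.X n) (g : G) :
    rowOp π T n (htmul π.toHom ζ g) = T n ζ g :=
  HilbertTensor.lift_htmul (hT.bounded n) zero_le_one ζ g

lemma norm_rowOp_le (hT : IsCovariantRep S π T) (n : ℕ) : ‖rowOp π T n‖ ≤ 1 :=
  ContinuousLinearMap.opNorm_le_bound _ zero_le_one
    (HilbertTensor.norm_lift_le (hT.bounded n) zero_le_one)

lemma rowOp_leftRep (hT : IsCovariantRep S π T) (n : ℕ) (a : M)
    (z : HilbertTensor (S.X n) π.toHom) :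
    rowOp π T n ((S.X n).leftRep π.toHom a z) = π.toHom a (rowOp π T n z) := by
  have : rowOp π T n ∘L (S.X n).leftRep π.toHom a = π.toHom a ∘L rowOp π T n :=
    HilbertTensor.clm_ext fun ζ g => by
      rw [ContinuousLinearMap.comp_apply, ContinuousLinearMap.comp_apply,
        AStarCorrespondence.leftRep_htmul, hT.rowOp_htmul, hT.rowOp_htmul, hT.apply_left]
  exact DFunLike.congr_fun this z

variable (π T) in
/-- The positive operator `T_n T_n*` on `G`, where `T_n = rowOp π T n`. -/
def rangeOp (n : ℕ) : G →L[ℂ] G := rowOp π T n ∘L (rowOp π T n).adjoint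

lemma inner_rangeOp (n : ℕ) (g : G) :
    (inner ℂ (rangeOp π T n g) g : ℂ) = ((‖(rowOp π T n).adjoint g‖ ^ 2 : ℝ) : ℂ) := by
  rw [← inner_conj_symm]
  change starRingEnd ℂ (inner ℂ g (rowOp π T n ((rowOp π T n).adjoint g))) = _
  rw [← ContinuousLinearMap.adjoint_inner_left, inner_self_eq_norm_sq_to_K]
  simp

/-- `X 0 ⊗ G = G`, as `M` acts nondegenerately on `G`. -/
lemma rangeOp_zero (hT : IsCovariantRep S π T) : rangeOp π T 0 = .id ℂ G := by
  refine comp_adjoint_eq_id_of_denseRange _ ?_ ?_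
  · refine HilbertTensor.inner_lift_lift fun ζ g ζ' g' => ?_
    obtain ⟨a, rfl⟩ := S.unit.surjective ζ
    obtain ⟨b, rfl⟩ := S.unit.surjective ζ'
    rw [hT.unit, hT.unit, S.mip_unit, inner_rep_left, map_mul]
    rfl
  · have h1 : (LinearMap.range (rowOp π T 0).toLinearMap).topologicalClosure = ⊤ := by
      rw [eq_top_iff, ← π.nondegenerate]
      refine Submodule.topologicalClosure_mono (Submodule.span_le.2 ?_)
      rintro _ ⟨a, g, rfl⟩
      exact ⟨htmul π.toHom (S.unit a) g, (hT.rowOp_htmul 0 (S.unit a) g).trans (hT.unit a g)⟩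
    have h2 := Submodule.dense_iff_topologicalClosure_eq_top.2 h1
    exact h2

/-- `T_{n+1} T_{n+1}* = T_n (1 ⊗ T_1 T_1*) T_n*`: the operator `T_{n+1}` composed with the coisometry
`X n ⊗ (X 1 ⊗ G) → X (n + 1) ⊗ G` is `T_n (1 ⊗ T_1)`. -/
lemma rangeOp_succ (hM : IsAStarAlgebra k M) (hT : IsCovariantRep S π T) (n : ℕ) :
    rangeOp π T (n + 1) = rowOp π T n ∘L
      HilbertTensor.mapRight (S.X n) (ψ := π.toHom) (φ := π.toHom) (rangeOp π T 1) ∘L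
        (rowOp π T n).adjoint := by
  obtain ⟨V, hV, hVV⟩ := (S.coisometric n 1).exists_coisometry hM π.toHom
    fun hk => (π.normal hk).isStronglyNormal
  set A := HilbertTensor.mapRight (S.X n) (ψ := (S.X 1).leftRep π.toHom) (φ := π.toHom)
    (rowOp π T 1) with hA
  have hint := hT.rowOp_leftRep 1
  have h1 : rowOp π T (n + 1) ∘L V = rowOp π T n ∘L A := by
    refine HilbertTensor.clm_ext fun ζ z => ?_
    have h2 : (rowOp π T (n + 1) ∘L V) ∘L HilbertTensor.htmulR _ ζ =
        (rowOp π T n ∘L A) ∘L HilbertTensor.htmulR _ ζ := HilbertTensor.clm_ext fun η g => by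
      simp only [ContinuousLinearMap.comp_apply, HilbertTensor.htmulR_apply]
      rw [hV, hT.rowOp_htmul, hA, HilbertTensor.mapRight_htmul hint, hT.rowOp_htmul,
        hT.rowOp_htmul, hT.mul]
    exact DFunLike.congr_fun h2 z
  have h3 : A ∘L A.adjoint =
      HilbertTensor.mapRight (S.X n) (ψ := π.toHom) (φ := π.toHom) (rangeOp π T 1) := by
    rw [hA, HilbertTensor.adjoint_mapRight hint,
      HilbertTensor.mapRight_comp (HilbertTensor.intertwines_adjoint hint) hint]
    rfl
  calc rangeOp π T (n + 1)
      = rowOp π T (n + 1) ∘L (V ∘L V.adjoint) ∘L (rowOp π T (n + 1)).adjoint := by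
        rw [hVV, ContinuousLinearMap.id_comp]; rfl
    _ = (rowOp π T (n + 1) ∘L V) ∘L (rowOp π T (n + 1) ∘L V).adjoint := by
        rw [ContinuousLinearMap.adjoint_comp]; rfl
    _ = rowOp π T n ∘L (A ∘L A.adjoint) ∘L (rowOp π T n).adjoint := by
        rw [h1, ContinuousLinearMap.adjoint_comp]; rfl
    _ = _ := by rw [h3]

lemma rangeOp_intertwines (hT : IsCovariantRep S π T) (n : ℕ) (a : M) (g : G) :
    rangeOp π T n (π.toHom a g) = π.toHom a (rangeOp π T n g) := by
  change rowOp π T n ((rowOp π T n).adjoint _) = _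
  rw [HilbertTensor.intertwines_adjoint (hT.rowOp_leftRep n), hT.rowOp_leftRep]
  rfl

variable (π T) in
/-- The defect operator `Δ = (1 - T_1 T_1*)^(1/2)`. -/
def defectOp : G →L[ℂ] G := CFC.sqrt (1 - rangeOp π T 1)

lemma one_sub_rangeOp_nonneg (hT : IsCovariantRep S π T) (n : ℕ) : 0 ≤ 1 - rangeOp π T n := by
  rw [nonneg_iff_inner_nonneg]
  intro g
  have h0 : (inner ℂ g g : ℂ) = ((‖g‖ ^ 2 : ℝ) : ℂ) := by
    rw [inner_self_eq_norm_sq_to_K]; simp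
  rw [sub_apply, inner_sub_left, inner_rangeOp, one_apply_eq_self, h0]
  have h1 := (rowOp π T n).adjoint.le_of_opNorm_le
    ((LinearIsometryEquiv.norm_map _ _).trans_le (hT.norm_rowOp_le n)) g
  rw [one_mul] at h1
  rw [sub_nonneg, Complex.real_le_real]
  exact pow_le_pow_left₀ (norm_nonneg _) h1 2

lemma defectOp_mul_self (hT : IsCovariantRep S π T) :
    defectOp π T * defectOp π T = 1 - rangeOp π T 1 :=
  CFC.sqrt_mul_sqrt_self _ (hT.one_sub_rangeOp_nonneg 1)

lemma adjoint_defectOp : (defectOp π T).adjoint = defectOp π T :=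
  (CFC.sqrt_nonneg _).isSelfAdjoint

lemma defectOp_intertwines (hT : IsCovariantRep S π T) (a : M) (g : G) :
    defectOp π T (π.toHom a g) = π.toHom a (defectOp π T g) := by
  have h1 : Commute (1 - rangeOp π T 1) (π.toHom a) := by
    refine (Commute.one_left _).sub_left ?_
    ext1 g
    exact hT.rangeOp_intertwines 1 a g
  have h2 : Commute (defectOp π T) (π.toHom a) := h1.cfcₙ_nnreal _
  exact DFunLike.congr_fun h2.eq g

variable (π T) in
/-- The operator `T_n (1 ⊗ Δ)`, a component of the Poisson transform. -/
def poissonOp (n : ℕ) : HilbertTensor (S.X n) π.toHom →L[ℂ] G :=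
  rowOp π T n ∘L
    HilbertTensor.mapRight (S.X n) (ψ := π.toHom) (φ := π.toHom) (defectOp π T)

lemma poissonOp_htmul (hT : IsCovariantRep S π T) (n : ℕ) (ζ : S.X n) (g : G) :
    poissonOp π T n (htmul π.toHom ζ g) = T n ζ (defectOp π T g) := by
  rw [poissonOp, ContinuousLinearMap.comp_apply,
    HilbertTensor.mapRight_htmul hT.defectOp_intertwines, hT.rowOp_htmul]

/-- `T_n (1 ⊗ Δ²) T_n* = T_n T_n* - T_{n+1} T_{n+1}*`. -/
lemma poissonOp_comp_adjoint (hM : IsAStarAlgebra k M) (hT : IsCovariantRep S π T) (n : ℕ) :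
    poissonOp π T n ∘L (poissonOp π T n).adjoint = rangeOp π T n - rangeOp π T (n + 1) := by
  set B := HilbertTensor.mapRight (S.X n) (ψ := π.toHom) (φ := π.toHom) (defectOp π T) with hB
  have hBadj : B.adjoint = B := by
    rw [hB, HilbertTensor.adjoint_mapRight hT.defectOp_intertwines, adjoint_defectOp]
  have hBB : B ∘L B = .id ℂ _ -
      HilbertTensor.mapRight (S.X n) (ψ := π.toHom) (φ := π.toHom) (rangeOp π T 1) :=
    HilbertTensor.clm_ext fun ζ g => by
      rw [hB, ContinuousLinearMap.comp_apply, HilbertTensor.mapRight_htmul hT.defectOp_intertwines,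
        HilbertTensor.mapRight_htmul hT.defectOp_intertwines, sub_apply,
        HilbertTensor.mapRight_htmul (hT.rangeOp_intertwines 1)]
      have h1 : defectOp π T (defectOp π T g) = g - rangeOp π T 1 g :=
        DFunLike.congr_fun hT.defectOp_mul_self g
      rw [h1]
      exact map_sub (HilbertTensor.htmulR π.toHom ζ) g _
  calc poissonOp π T n ∘L (poissonOp π T n).adjoint
      = rowOp π T n ∘L (B ∘L B) ∘L (rowOp π T n).adjoint := by
        rw [poissonOp, ContinuousLinearMap.adjoint_comp, ← hB, hBadj]; rfl
    _ = _ := by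
        rw [hBB, hT.rangeOp_succ hM n, ContinuousLinearMap.sub_comp, ContinuousLinearMap.comp_sub,
          ContinuousLinearMap.id_comp]
        rfl

/-- The Poisson transform: if `T_n T_n* → 0` strongly, then the operators `T_n (1 ⊗ Δ)` are the
components of a coisometry, since `∑ T_n (1 ⊗ Δ²) T_n* = ∑ (T_n T_n* - T_{n+1} T_{n+1}*) = 1`
telescopes. -/
lemma exists_poisson (hM : IsAStarAlgebra k M) (hT : IsCovariantRep S π T)
    (hpure : ∀ g, Filter.Tendsto (fun n => ‖(rowOp π T n).adjoint g‖ ^ 2) Filter.atTop (nhds 0)) :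
    ∃ Q : S.FockTensor π →L[ℂ] G, (∀ (n : ℕ) (ζ : S.X n) (g : G),
        Q (lp.single 2 n (htmul π.toHom ζ g)) = T n ζ (defectOp π T g)) ∧
      Q ∘L Q.adjoint = .id ℂ G := by
  have hP : ∀ n (g : G), ‖(poissonOp π T n).adjoint g‖ ^ 2 =
      ‖(rowOp π T n).adjoint g‖ ^ 2 - ‖(rowOp π T (n + 1)).adjoint g‖ ^ 2 := fun n g => by
    have h1 : (inner ℂ ((poissonOp π T n ∘L (poissonOp π T n).adjoint) g) g : ℂ) =
        ((‖(poissonOp π T n).adjoint g‖ ^ 2 : ℝ) : ℂ) := by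
      rw [ContinuousLinearMap.comp_apply, ← ContinuousLinearMap.adjoint_inner_right,
        inner_self_eq_norm_sq_to_K]
      simp
    rw [hT.poissonOp_comp_adjoint hM, sub_apply, inner_sub_left, inner_rangeOp, inner_rangeOp,
      ← Complex.ofReal_sub] at h1
    exact (Complex.ofReal_injective h1).symm
  obtain ⟨Q, hQ, hQQ⟩ := exists_coisometry_of_hasSum (poissonOp π T) fun g => by
    simp only [hP]
    rw [hasSum_iff_tendsto_nat_of_nonneg (fun n => by rw [← hP]; positivity)]
    have h1 : ‖(rowOp π T 0).adjoint g‖ ^ 2 = ‖g‖ ^ 2 := by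
      have h2 := inner_rangeOp (π := π) (T := T) 0 g
      rw [hT.rangeOp_zero] at h2
      rw [← inner_self_eq_norm_sq (𝕜 := ℂ) g]
      exact (congrArg Complex.re h2).symm
    simp only [Finset.sum_range_sub', h1]
    simpa using (hpure g).const_sub (‖g‖ ^ 2)
  exact ⟨Q, fun n ζ g => by rw [hQ, hT.poissonOp_htmul], hQQ⟩

end IsCovariantRep

/-! ### Invariant subspaces of the shift -/

namespace SubproductSystem

variable {k : AStarKind} {M : Type u} [NonUnitalCStarAlgebra M] [PartialOrder M]
  [StarOrderedRing M] {S : SubproductSystem.{u, v} k M}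
  {E : Type w} [NormedAddCommGroup E] [InnerProductSpace ℂ E] [CompleteSpace E]
  {ψ : AStarRep k M E}

lemma shift_add {n : ℕ} (ζ ζ' : S.X n) : S.shift ψ (ζ + ζ') = S.shift ψ ζ + S.shift ψ ζ' :=
  S.fock_clm_ext ψ fun m η h => by
    simp [shift_single, HilbertTensor.htmul_add_left]

lemma shift_smul {n : ℕ} (c : ℂ) (ζ : S.X n) : S.shift ψ (c • ζ) = c • S.shift ψ ζ :=
  S.fock_clm_ext ψ fun m η h => by
    simp [shift_single, HilbertTensor.htmul_smul_left]

section Isometry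

variable {G : Type*} [NormedAddCommGroup G] [InnerProductSpace ℂ G] [CompleteSpace G]
  {π : AStarRep k M G} {T : ∀ n, S.X n →ₗ[ℂ] G →ₗ[ℂ] G} (J : G →ₗᵢ[ℂ] S.FockTensor ψ)

/-- Operators that are intertwined with the shift by an isometry form a covariant representation. -/
lemma isCovariantRep_of_isometry (hM : IsAStarAlgebra k M)
    (hJ : ∀ n ζ g, J (T n ζ g) = S.shift ψ ζ (J g))
    (hπ : ∀ a g, J (π.toHom a g) = S.fockRep ψ a (J g)) : IsCovariantRep S π T where
  bounded n N ζ g := by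
    have h1 := S.norm_sum_shift_sq_le ψ hM n ζ fun i => J (g i)
    simp only [← hJ, ← hπ, J.inner_map_map, ← map_sum, J.norm_map] at h1
    rwa [one_pow, one_mul]
  unit a g := J.injective (by rw [hJ, hπ, fockRep_apply])
  mul n m ζ η g := J.injective (by rw [hJ, hJ, hJ, shift_mul, ContinuousLinearMap.comp_apply])

/-- The shift is pure: `T_n T_n* → 0` strongly, since the range of `T_n` lies in degrees `≥ n`. -/
lemma tendsto_rowOp_adjoint (hT : IsCovariantRep S π T)
    (hJ : ∀ n ζ g, J (T n ζ g) = S.shift ψ ζ (J g)) (g : G) :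
    Filter.Tendsto (fun n => ‖(IsCovariantRep.rowOp π T n).adjoint g‖ ^ 2) Filter.atTop
      (nhds 0) := by
  set r : ℕ → S.FockTensor ψ := fun n =>
    J g - ∑ l ∈ Finset.range n, lp.single 2 l ((J g) l) with hr
  have hr0 : Filter.Tendsto (fun n => ‖r n‖ ^ 2) Filter.atTop (nhds 0) := by
    have h1 := (lp.hasSum_single (p := 2) (by simp) (J g)).tendsto_sum_nat
    have h2 := ((tendsto_const_nhds (x := J g)).sub h1).norm.pow 2
    simpa using h2
  refine squeeze_zero (fun n => by positivity) (fun n => ?_) hr0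
  refine pow_le_pow_left₀ (norm_nonneg _) ?_ 2
  -- components of `J g` of degree `< n` do not contribute to `⟨T_n z, g⟩`
  have h1 : ∀ z : HilbertTensor (S.X n) π.toHom, ∀ l < n,
      (J (IsCovariantRep.rowOp π T n z)) l = 0 := fun z l hl => by
    let ev := lp.evalCLM ℂ (fun n => HilbertTensor (S.X n) ψ.toHom) 2 l
    have h2 : ev ∘L J.toContinuousLinearMap ∘L IsCovariantRep.rowOp π T n = 0 :=
      HilbertTensor.clm_ext fun ζ g' => by
        change (J (IsCovariantRep.rowOp π T n (htmul π.toHom ζ g'))) l = 0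
        rw [hT.rowOp_htmul, hJ]
        exact S.shift_apply_of_lt ψ ζ _ hl
    exact DFunLike.congr_fun h2 z
  have h2 : ∀ z, inner ℂ (IsCovariantRep.rowOp π T n z) g =
      inner ℂ (J (IsCovariantRep.rowOp π T n z)) (r n) := fun z => by
    rw [hr, inner_sub_right, inner_sum, Finset.sum_eq_zero, sub_zero, J.inner_map_map]
    intro l hl
    rw [lp.inner_single_right, h1 z l (by simpa using hl)]
    exact inner_zero_left _
  set z := (IsCovariantRep.rowOp π T n).adjoint g with hz
  have h3 : ‖z‖ ^ 2 ≤ ‖z‖ * ‖r n‖ := by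
    rw [← inner_self_eq_norm_sq (𝕜 := ℂ)]
    nth_rw 2 [hz]
    rw [ContinuousLinearMap.adjoint_inner_right, h2]
    refine (Complex.re_le_norm _).trans ((norm_inner_le_norm _ _).trans ?_)
    rw [J.norm_map]
    gcongr
    have := (IsCovariantRep.rowOp π T n).le_of_opNorm_le (hT.norm_rowOp_le n) z
    rwa [one_mul] at this
  by_contra! h
  nlinarith [norm_nonneg (r n)]

/-- An isometric image in `F_X ⊗_ψ E` on which the shift acts is the range of an inner
multi-analytic operator, namely of the Poisson transform. -/
lemma exists_isMultiAnalytic_of_isometry (hM : IsAStarAlgebra k M)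
    (hJ : ∀ n ζ g, J (T n ζ g) = S.shift ψ ζ (J g))
    (hπ : ∀ a g, J (π.toHom a g) = S.fockRep ψ a (J g)) :
    ∃ P : S.FockTensor π →L[ℂ] S.FockTensor ψ, S.IsMultiAnalytic π ψ P ∧ IsPartialIsometry P ∧
      LinearMap.range P.toLinearMap = LinearMap.range J.toLinearMap := by
  have hT : IsCovariantRep S π T := isCovariantRep_of_isometry J hM hJ hπ
  obtain ⟨Q, hQ, hQQ⟩ := hT.exists_poisson hM (tendsto_rowOp_adjoint J hT hJ)
  refine ⟨J.toContinuousLinearMap ∘L Q, fun n ζ => S.fock_clm_ext _ fun m η g => ?_,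
    fun x hx => ?_, ?_⟩
  · change J (Q (S.shift π ζ (lp.single 2 m (htmul π.toHom η g)))) =
      S.shift ψ ζ (J (Q (lp.single 2 m (htmul π.toHom η g))))
    rw [S.shift_single, hQ, hQ, hT.mul, hJ]
  · refine (J.norm_map _).trans (norm_eq_of_mem_ker_orthogonal hQQ ?_)
    convert hx using 2
    ext z
    exact (map_eq_zero_iff J J.injective).symm
  · ext x
    constructor
    · rintro ⟨z, rfl⟩
      exact ⟨Q z, rfl⟩
    · rintro ⟨g, rfl⟩
      exact ⟨Q.adjoint g, congrArg J (DFunLike.congr_fun hQQ g)⟩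

end Isometry

section Invariant

variable {W : Submodule ℂ (S.FockTensor ψ)} [CompleteSpace W] (hW : S.IsShiftInvariant ψ W)

/-- The representation of `M` on a shift-invariant subspace. -/
def invariantRep : AStarRep k M W where
  toHom := subRep (S.fockRep ψ) W fun a v hv => hW 0 (S.unit a) v hv
  nondegenerate := by
    rw [rep_nondegenerate_iff]
    intro v hv
    exact Subtype.ext (S.fockRep_nondegenerate ψ v fun a => congrArg Subtype.val (hv a))
  normal hk := ((S.isStronglyNormal_fockRep ψ hk).subRep W _).isNormalMap

/-- The shift on an invariant subspace `W`, as a bilinear map `X n × W → W`. -/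
def invariantShift (n : ℕ) : S.X n →ₗ[ℂ] W →ₗ[ℂ] W :=
  LinearMap.mk₂ ℂ (fun ζ w => ⟨S.shift ψ ζ w, hW n ζ w w.2⟩)
    (fun ζ ζ' w => Subtype.ext (DFunLike.congr_fun (shift_add ζ ζ') (w : S.FockTensor ψ)))
    (fun c ζ w => Subtype.ext (DFunLike.congr_fun (shift_smul c ζ) (w : S.FockTensor ψ)))
    (fun ζ w w' => Subtype.ext (map_add (S.shift ψ ζ) (w : S.FockTensor ψ) w'))
    (fun c ζ w => Subtype.ext (map_smul (S.shift ψ ζ) c (w : S.FockTensor ψ)))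

end Invariant

end SubproductSystem

end

theorem theorem3p4
    (k : AStarKind)
    (M : Type u) [NonUnitalCStarAlgebra M] [PartialOrder M] [StarOrderedRing M]
    (hM : IsAStarAlgebra k M)
    (X : SubproductSystem.{u, v} k M)
    (E : Type w) [NormedAddCommGroup E] [InnerProductSpace ℂ E] [CompleteSpace E]
    (ψ : AStarRep k M E)
    (S : Submodule ℂ (X.FockTensor ψ)) (hS : IsClosed (S : Set (X.FockTensor ψ))) :
    X.IsShiftInvariant ψ S ↔
      ∃ (E' : Type (max v w)) (_ : NormedAddCommGroup E') (_ : InnerProductSpace ℂ E')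
        (_ : CompleteSpace E') (π : AStarRep k M E')
        (P : X.FockTensor π →L[ℂ] X.FockTensor ψ),
        X.IsMultiAnalytic π ψ P ∧ IsPartialIsometry P ∧ LinearMap.range P.toLinearMap = S := by
  constructor
  · intro hinv
    have : CompleteSpace S := hS.completeSpace_coe
    obtain ⟨P, hP, hPiso, hPrange⟩ := SubproductSystem.exists_isMultiAnalytic_of_isometry
      (π := SubproductSystem.invariantRep hinv) (T := SubproductSystem.invariantShift hinv)
      S.subtypeₗᵢ hM (fun _ _ _ => rfl) (fun _ _ => rfl)
    exact ⟨S, inferInstance, inferInstance, inferInstance, SubproductSystem.invariantRep hinv, P,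
      hP, hPiso, hPrange.trans S.range_subtype⟩
  · rintro ⟨E', _, _, _, π, P, hP, -, rfl⟩ n ζ _ ⟨z, rfl⟩
    exact ⟨X.shift π ζ z, DFunLike.congr_fun (hP n ζ) z⟩
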